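/- Let $n\ge 1$ and $Q=2n+2$. Let $\mathbb H^n=\mathbb C^n\times\mathbb R$ be the Heisenberg group, and for $\lambda\in\mathbb R\setminus\{0\}$ let $\pi_\lambda$ be the Schrödinger representation on $L^2(\mathbb R^n)$, $$\pi_\lambda(x+iy,t)\varphi(\xi)=e^{i\lambda(x\cdot\xi+\frac12x\cdot y+t)}\varphi(\xi+y).$$ For a finite signed Borel measure $\sigma$ on $\mathbb H^n$ let $\widehat\sigma(\lambda)\varphi=\int_{\mathbb H^n}\pi_\lambda(z,t)\varphi\,d\sigma(z,t)$. For $\alpha\in\mathbb N^n$ let $\Phi_\alpha^\lambda(x)=|\lambda|^{n/4}\prod_{j=1}^n h_{\alpha_j}(|\lambda|^{1/2}x_j)$, with $h_k$ the $L^2(\mathbb R)$-normalized Hermite functions. Let $L_k^{\delta}$ be the generalized Laguerre polynomials, $r_k=\big(k!/\Gamma(k+n)\big)^{1/2}$, $\Lambda_k^{n-1}(u)=r_kL_k^{n-1}(u)e^{-u/2}u^{(n-1)/2}$ and $$\varphi_k^\lambda(z)=\Big(\frac{|\lambda|}{2\pi}\Big)^nL_k^{n-1}\big(\tfrac12|\lambda||z|^2\big)e^{-\frac14|\lambda||z|^2}.$$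 For a function $f(z,t)=f_\#(|z|,t)$ on $\mathbb H^n$ let $$\widehat f(\lambda,k)=r_k\int_0^\infty\Big(\int_{\mathbb R}f_\#(r,t)e^{i\lambda t}\,dt\Big)(|\lambda|r^2)^{\frac{1-n}2}\Lambda_k^{n-1}\big(\tfrac12|\lambda|r^2\big)r^{2n-1}\,dr .$$ Let $\Psi\in\mathcal S(\mathbb R)$ be nonnegative and even, with support in $[-\frac12,\frac12]$ and $\|\Psi\|_{L^2}=\sqrt{2\pi}$, and put $F(t)=\big(\frac1{2\pi}\int_{\mathbb R}\Psi(\lambda)e^{-i\lambda t}d\lambda\big)^2$. For $s>0$ let $q_s$ be the heat kernel $$q_s(z,t)=\frac1{2\pi}\int_{\mathbb R}e^{-i\lambda t}\sum_{k=0}^\infty e^{-(2k+n)|\lambda|s}\varphi_k^\lambda(z)\,d\lambda ,\qquad\text{and}\qquad K_s(z,t)=\int_{\mathbb R}F(t-\tau)q_s(z,\tau)\,d\tau .$$ Let $\nu_k=4k+2n$, $\langle x\rangle=1+|x|$, and for $\Lambda>0$ let $$F_\Lambda=\{(k,\lambda)\in\mathbb N\times(\mathbb R\setminus\{0\}):\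 \langle\lambda\nu_k\rangle\le\Lambda,\ |\lambda|\le1\},$$ with complement $F_\Lambda^c$ in $\mathbb N\times(\mathbb R\setminus\{0\})$. Given a Borel probability measure $\mu$ on $\mathbb H^n$ and points $p_1,\dots,p_N\in\mathbb H^n$, put $\sigma=\sum_{j=1}^N\delta_{p_j}-N\mu$ and $$B=\sum_{k=0}^\infty\int_{\mathbb R}\chi_{F_\Lambda^c}(k,\lambda)\,\widehat{K_s}(\lambda,k)\sum_{|\alpha|=k}\big\|\widehat\sigma(\lambda)\Phi_\alpha^\lambda\big\|_{L^2(\mathbb R^n)}^2\,|\lambda|^n\,d\lambda .$$ **Proposition 7.6.** There is a constant $C>0$ depending only on $n$ such that, for all $\Psi$ as above, all Borel probability measures $\mu$ on $\mathbb H^n$, all $N$ and all $p_1,\dots,p_N\in\mathbb H^n$, and all $0<s<1$ and $\Lambda$ with $s\Lambda>1$, the sum and integrals defining $B$ converge absolutely and $$|B|\le C\,N^2\,s^{-1}\,\Lambda^{\frac{Q-4}2}\,e^{-\frac12s\Lambda}.$$ -/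

import Mathlib

open MeasureTheory SchwartzMap

noncomputable section

namespace HeisenbergDiscrepancy

/-- The Heisenberg group `ℍⁿ = ℂⁿ × ℝ` as a measurable (and topological) space; a point is `(z, t)`,
with `z = x + i y`, and `‖z‖` is the Euclidean norm of `z`. -/
abbrev Heis (n : ℕ) : Type := EuclideanSpace ℂ (Fin n) × ℝ

/-- The homogeneous dimension `Q = 2n + 2`. -/
def homDim (n : ℕ) : ℝ := 2 * n + 2

/-- The Hilbert space `L²(ℝⁿ)` of complex valued functions. -/
abbrev L2 (n : ℕ) : Type := Lp ℂ 2 (volume : Measure (EuclideanSpace ℝ (Fin n)))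

/-! ### Schrödinger representations and the group Fourier transform of a finite signed measure -/

/-- The vector `x ∈ ℝⁿ` of real parts of `z = x + i y`. -/
def rePart {n : ℕ} (z : EuclideanSpace ℂ (Fin n)) : EuclideanSpace ℝ (Fin n) :=
  WithLp.toLp 2 fun i => (z i).re

/-- The vector `y ∈ ℝⁿ` of imaginary parts of `z = x + i y`. -/
def imPart {n : ℕ} (z : EuclideanSpace ℂ (Fin n)) : EuclideanSpace ℝ (Fin n) :=
  WithLp.toLp 2 fun i => (z i).im

/-- `π_l(x, y, t) φ (ξ) = exp(i l (x·ξ + x·y/2 + t)) φ(ξ + y)`, on functions. -/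
def schrodingerFun {n : ℕ} (l : ℝ) (p : Heis n) (φ : EuclideanSpace ℝ (Fin n) → ℂ)
    (ξ : EuclideanSpace ℝ (Fin n)) : ℂ :=
  Complex.exp (Complex.I * l *
      ((inner ℝ (rePart p.1) ξ + 1 / 2 * inner ℝ (rePart p.1) (imPart p.1) + p.2 : ℝ) : ℂ)) *
    φ (ξ + imPart p.1)

theorem memLp_schrodingerFun {n : ℕ} (l : ℝ) (p : Heis n) (φ : L2 n) :
    MemLp (schrodingerFun l p φ) 2 (volume : Measure (EuclideanSpace ℝ (Fin n))) := by
  have h1 : MemLp (fun ξ => (φ : EuclideanSpace ℝ (Fin n) → ℂ) (ξ + imPart p.1)) 2 volume :=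
    (Lp.memLp φ).comp_measurePreserving (measurePreserving_add_right volume (imPart p.1))
  refine h1.of_le ?_ (Filter.Eventually.of_forall fun ξ => ?_)
  · refine AEStronglyMeasurable.mul ?_ h1.1
    exact Continuous.aestronglyMeasurable (by fun_prop)
  · unfold schrodingerFun
    rw [norm_mul, mul_assoc, ← Complex.ofReal_mul, mul_comm Complex.I,
      Complex.norm_exp_ofReal_mul_I, one_mul]

/-- The Schrödinger representation `π_l(p)`, acting on `L²(ℝⁿ)`. -/
def schrodinger {n : ℕ} (l : ℝ) (p : Heis n) (φ : L2 n) : L2 n :=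
  (memLp_schrodingerFun l p φ).toLp _

/-- The group Fourier transform `σ̂(l) = ∫ π_l(p) dσ(p)` of a finite signed measure `σ` on `ℍⁿ`,
applied to `φ ∈ L²(ℝⁿ)`: the Bochner integral of `p ↦ π_l(p) φ` against `σ`. -/
def fourierSigned {n : ℕ} (σ : SignedMeasure (Heis n)) (l : ℝ) (φ : L2 n) : L2 n :=
  VectorMeasure.integral σ (fun p => schrodinger l p φ) (ContinuousLinearMap.lsmul ℝ ℝ).flip

/-- The signed measure `σ = ∑ⱼ δ_{ζ j} - N μ`. -/
def discMeasure {n N : ℕ} (ζ : Fin N → Heis n) (μ : Measure (Heis n)) [IsFiniteMeasure μ] :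
    SignedMeasure (Heis n) :=
  ∑ j, (Measure.dirac (ζ j)).toSignedMeasure - (N : ℝ) • μ.toSignedMeasure

/-! ### Hermite functions -/

/-- The (physicists') Hermite polynomial `H_k(t) = (-1)^k exp(t²) (d/dt)^k exp(-t²)`. -/
def hermiteH (k : ℕ) (t : ℝ) : ℝ :=
  (-1) ^ k * Real.exp (t ^ 2) * iteratedDeriv k (fun u : ℝ => Real.exp (-u ^ 2)) t

/-- The normalized Hermite function `h_k`. -/
def hermiteFun (k : ℕ) (t : ℝ) : ℝ :=
  1 / √(2 ^ k * (k.factorial : ℝ) * √Real.pi) * hermiteH k t * Real.exp (-t ^ 2 / 2)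

/-- The rescaled Hermite function
`Φ_α^l(x) = |l|^{n/4} Φ_α(|l|^{1/2} x)`, where `Φ_α(x) = ∏ⱼ h_{α j}(x j)`. -/
def hermiteScaledFun {n : ℕ} (α : Fin n → ℕ) (l : ℝ) (x : EuclideanSpace ℝ (Fin n)) : ℂ :=
  ((|l| ^ ((n : ℝ) / 4) * ∏ j, hermiteFun (α j) (|l| ^ (1 / 2 : ℝ) * x j) : ℝ) : ℂ)

theorem exists_iteratedDeriv_gauss (k : ℕ) : ∃ P : Polynomial ℝ,
    iteratedDeriv k (fun u : ℝ => Real.exp (-u ^ 2)) = fun t => P.eval t * Real.exp (-t ^ 2) := by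
  induction k with
  | zero => exact ⟨1, by ext t; simp⟩
  | succ k ih =>
    obtain ⟨P, hP⟩ := ih
    refine ⟨Polynomial.derivative P - 2 * Polynomial.X * P, ?_⟩
    ext t
    rw [iteratedDeriv_succ, hP]
    have h1 : HasDerivAt (fun t : ℝ => Real.exp (-t ^ 2)) (Real.exp (-t ^ 2) * -(2 * t)) t := by
      have := ((hasDerivAt_pow 2 t).neg).exp
      simpa using this
    have h2 := ((P.hasDerivAt t).mul h1).deriv
    change deriv (fun t => P.eval t * Real.exp (-t ^ 2)) t = _ at h2
    rw [h2]
    simp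
    ring

theorem exists_hermiteFun_eq (k : ℕ) : ∃ P : Polynomial ℝ,
    hermiteFun k = fun t => P.eval t * Real.exp (-t ^ 2 / 2) := by
  obtain ⟨P, hP⟩ := exists_iteratedDeriv_gauss k
  refine ⟨Polynomial.C (1 / √(2 ^ k * (k.factorial : ℝ) * √Real.pi) * (-1) ^ k) * P, ?_⟩
  ext t
  simp only [hermiteFun, hermiteH, hP, Polynomial.eval_mul, Polynomial.eval_C]
  have : Real.exp (t ^ 2) * Real.exp (-t ^ 2) = 1 := by rw [← Real.exp_add]; simp
  linear_combination (1 / √(2 ^ k * (k.factorial : ℝ) * √Real.pi) * (-1) ^ k * P.eval t *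
    Real.exp (-t ^ 2 / 2)) * this

theorem integrable_poly_gauss (P : Polynomial ℝ) :
    Integrable (fun t : ℝ => P.eval t * Real.exp (-t ^ 2)) := by
  induction P using Polynomial.induction_on' with
  | add p q hp hq =>
    refine (hp.add hq).congr (Filter.Eventually.of_forall fun t => ?_)
    simp [add_mul]
  | monomial m a =>
    have := (integrable_rpow_mul_exp_neg_mul_sq (b := 1) one_pos (s := m)
      (by have : (0 : ℝ) ≤ m := m.cast_nonneg
          linarith)).const_mul a
    simpa [mul_assoc] using this

theorem integrable_hermiteFun_sq (k : ℕ) : Integrable (fun t : ℝ => hermiteFun k t ^ 2) := by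
  obtain ⟨P, hP⟩ := exists_hermiteFun_eq k
  refine (integrable_poly_gauss (P ^ 2)).congr (Filter.Eventually.of_forall fun t => ?_)
  simp only [hP, Polynomial.eval_pow, mul_pow]
  rw [← Real.exp_nat_mul]
  congr 2
  push_cast
  ring

theorem continuous_hermiteFun (k : ℕ) : Continuous (hermiteFun k) := by
  obtain ⟨P, hP⟩ := exists_hermiteFun_eq k
  rw [hP]
  fun_prop

theorem memLp_hermiteScaledFun {n : ℕ} [NeZero n] (α : Fin n → ℕ) (l : ℝ) :
    MemLp (hermiteScaledFun α l) 2 (volume : Measure (EuclideanSpace ℝ (Fin n))) := by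
  have hc : Continuous (hermiteScaledFun α l) := by
    unfold hermiteScaledFun
    have := continuous_hermiteFun
    fun_prop
  rw [memLp_two_iff_integrable_sq_norm hc.aestronglyMeasurable]
  rcases eq_or_ne l 0 with rfl | hl
  · have : ((n : ℝ) / 4) ≠ 0 := by
      have := NeZero.ne n
      positivity
    simp [hermiteScaledFun, Real.zero_rpow this]
  have h0 : |l| ^ (1 / 2 : ℝ) ≠ 0 := by positivity
  rw [← (PiLp.volume_preserving_toLp (Fin n)).integrable_comp_emb
    (MeasurableEquiv.toLp 2 _).measurableEmbedding]
  have h1 : Integrable (fun x : Fin n → ℝ =>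
      ∏ j, hermiteFun (α j) (|l| ^ (1 / 2 : ℝ) * x j) ^ 2) :=
    Integrable.fintype_prod
      (f := fun j (v : ℝ) => hermiteFun (α j) (|l| ^ (1 / 2 : ℝ) * v) ^ 2)
      fun j => (integrable_hermiteFun_sq (α j)).comp_mul_left' h0
  refine (h1.const_mul ((|l| ^ ((n : ℝ) / 4)) ^ 2)).congr (Filter.Eventually.of_forall fun x => ?_)
  simp only [hermiteScaledFun, Function.comp, Complex.norm_real, Real.norm_eq_abs, sq_abs, mul_pow,
    Finset.prod_pow]

/-- `Φ_α^l` as an element of `L²(ℝⁿ)`. -/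
def hermiteScaled {n : ℕ} [NeZero n] (α : Fin n → ℕ) (l : ℝ) : L2 n :=
  (memLp_hermiteScaledFun α l).toLp _

/-- `∑_{|α| = k} ‖σ̂(l) Φ_α^l‖²`. -/
def levelMass {n : ℕ} [NeZero n] (σ : SignedMeasure (Heis n)) (k : ℕ) (l : ℝ) : ℝ :=
  ∑ α ∈ Finset.piAntidiag (Finset.univ : Finset (Fin n)) k,
    ‖fourierSigned σ l (hermiteScaled α l)‖ ^ 2

/-! ### Laguerre functions and the Fourier coefficients of cylindrically radial functions -/

/-- The generalized Laguerre polynomial `L_k^δ`, for an integer type `δ ≥ 0`. -/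
def laguerreL (δ k : ℕ) (t : ℝ) : ℝ :=
  ∑ i ∈ Finset.range (k + 1),
    (-1) ^ i * ((k + δ).choose (k - i) : ℝ) / (i.factorial : ℝ) * t ^ i

/-- `r_k^δ = (k! / Γ(k + δ + 1))^{1/2}`. -/
def laguerreNorm (δ k : ℕ) : ℝ := √((k.factorial : ℝ) / Real.Gamma (k + δ + 1))

/-- The Laguerre function `Λ_k^δ(t) = r_k^δ L_k^δ(t) e^{-t/2} t^{δ/2}`. -/
def laguerreFun (δ k : ℕ) (t : ℝ) : ℝ :=
  laguerreNorm δ k * laguerreL δ k t * Real.exp (-t / 2) * t ^ ((δ : ℝ) / 2)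

/-- The rescaled Laguerre function `φ_k^l` on `ℂⁿ`. -/
def laguerreScaled {n : ℕ} (k : ℕ) (l : ℝ) (z : EuclideanSpace ℂ (Fin n)) : ℝ :=
  (|l| / (2 * Real.pi)) ^ n * laguerreL (n - 1) k (1 / 2 * |l| * ‖z‖ ^ 2) *
    Real.exp (-(1 / 4) * |l| * ‖z‖ ^ 2)

/-- The profile `f_#(r, t) = f(r e₁, t)` of a cylindrically radial function `f`, which is
characterized by `f(z, t) = f_#(‖z‖, t)`. -/
def radialProfile {n : ℕ} [NeZero n] (f : Heis n → ℂ) (r t : ℝ) : ℂ :=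
  f (EuclideanSpace.single 0 (r : ℂ), t)

/-- The Fourier coefficient `f̂(l, k)` of a cylindrically radial function `f`:
`r_k ∫₀^∞ f_#^l(r) (|l| r²)^{(1-n)/2} Λ_k^{n-1}(|l| r²/2) r^{2n-1} dr`, where
`f_#^l(r) = ∫ f_#(r, t) e^{i l t} dt`. -/
def radialCoeff {n : ℕ} [NeZero n] (f : Heis n → ℂ) (l : ℝ) (k : ℕ) : ℂ :=
  (laguerreNorm (n - 1) k : ℂ) * ∫ r in Set.Ioi (0 : ℝ),
    (∫ t : ℝ, radialProfile f r t * Complex.exp (Complex.I * l * t)) *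
      (((|l| * r ^ 2) ^ ((1 - (n : ℝ)) / 2) * laguerreFun (n - 1) k (1 / 2 * |l| * r ^ 2) *
        r ^ (2 * n - 1) : ℝ) : ℂ)

/-! ### The kernel `K_s` -/

/-- `F(t) = ((2π)⁻¹ ∫ Ψ(l) e^{-i l t} dl)²`. -/
def cutoff (Ψ : 𝓢(ℝ, ℝ)) (t : ℝ) : ℂ :=
  (1 / (2 * Real.pi) * ∫ l : ℝ, (Ψ l : ℂ) * Complex.exp (-Complex.I * l * t)) ^ 2

/-- `q_s^l(z) = ∑ₖ e^{-(2k+n)|l|s} φ_k^l(z)`, the Fourier transform in `t` of the heat kernel. -/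
def heatFourier {n : ℕ} (s l : ℝ) (z : EuclideanSpace ℂ (Fin n)) : ℝ :=
  ∑' k : ℕ, Real.exp (-(2 * k + n) * |l| * s) * laguerreScaled k l z

/-- The heat kernel `q_s(z, t) = (2π)⁻¹ ∫ q_s^l(z) e^{-i l t} dl` on `ℍⁿ`. -/
def heatKernel {n : ℕ} (s : ℝ) (p : Heis n) : ℂ :=
  1 / (2 * Real.pi) * ∫ l : ℝ, (heatFourier s l p.1 : ℂ) * Complex.exp (-Complex.I * l * p.2)

/-- `K_s(z, t) = ∫ F(t - τ) q_s(z, τ) dτ`. -/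
def kernelK {n : ℕ} (Ψ : 𝓢(ℝ, ℝ)) (s : ℝ) (p : Heis n) : ℂ :=
  ∫ τ : ℝ, cutoff Ψ (p.2 - τ) * heatKernel s (p.1, τ)

/-- `K_s` is cylindrically radial, with profile `radialProfile (kernelK Ψ s)`. -/
theorem kernelK_eq_radialProfile {n : ℕ} [NeZero n] (Ψ : 𝓢(ℝ, ℝ)) (s : ℝ) (p : Heis n) :
    kernelK Ψ s p = radialProfile (kernelK (n := n) Ψ s) ‖p.1‖ p.2 := by
  simp [radialProfile, kernelK, heatKernel, heatFourier, laguerreScaled]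

/-! ### The tail term `B` -/

/-- `ν_k = 4k + 2n`. -/
def nu (n k : ℕ) : ℝ := 4 * k + 2 * n

/-- The region `F_Λ = {(k, l) ∈ ℕ × ℝ* : ⟨l ν_k⟩ ≤ Λ, |l| ≤ 1}`, where `⟨x⟩ = 1 + |x|`. -/
def regionF (n : ℕ) (Λ : ℝ) : Set (ℕ × ℝ) :=
  {p | p.2 ≠ 0 ∧ 1 + |p.2 * nu n p.1| ≤ Λ ∧ |p.2| ≤ 1}

/-- The integrand `χ_{F_Λᶜ}(k, l) K̂_s(l, k) ∑_{|α| = k} ‖σ̂(l) Φ_α^l‖² |l|ⁿ` of `B`. (Complements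
are taken in `ℕ × ℝ` rather than `ℕ × ℝ*`; the difference is a null set for `dl`.) -/
def tailIntegrand {n : ℕ} [NeZero n] (Ψ : 𝓢(ℝ, ℝ)) (σ : SignedMeasure (Heis n)) (s Λ : ℝ)
    (k : ℕ) (l : ℝ) : ℂ :=
  (regionF n Λ)ᶜ.indicator (fun _ => (1 : ℂ)) (k, l) *
    radialCoeff (kernelK (n := n) Ψ s) l k * (levelMass σ k l : ℂ) * ((|l| ^ n : ℝ) : ℂ)

/-- The tail term `B = ∑ₖ ∫ χ_{F_Λᶜ}(k, l) K̂_s(l, k) ∑_{|α| = k} ‖σ̂(l) Φ_α^l‖² |l|ⁿ dl`. -/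
def tailB {n : ℕ} [NeZero n] (Ψ : 𝓢(ℝ, ℝ)) (σ : SignedMeasure (Heis n)) (s Λ : ℝ) : ℂ :=
  ∑' k : ℕ, ∫ l : ℝ, tailIntegrand Ψ σ s Λ k l

end HeisenbergDiscrepancy

end

/-! Convolving `q_s` with `F` in the central variable multiplies its Fourier transform in `t` by a
fixed symbol, the self-convolution of `Ψ` divided by 2π. This symbol vanishes for |l| > 1 because
`Ψ` lives in [-1/2, 1/2], and it is at most 1 because ‖Ψ‖² = 2π. Hence `radialCoeff_kernelK`: the
coefficient of `K_s` at (l, k) is that symbol times a constant times exp(-(2k+n)|l|s) =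
exp(-s|l|ν_k/2).

The other factor is elementary. Each π_l(p) is unitary and each Φ_α^l a unit vector, so ‖σ̂(l)Φ_α^l‖
≤ 2N; at most (k+1)^{n-1} indices α occur, so the level mass is at most 4N²(k+1)^{n-1}.

Put x = |l|ν_k. Off F_Λ, where the symbol does not vanish, x > Λ-1, and the integrand is O(N² ν_k⁻¹
xⁿ e^{-sx/2}). Since sΛ > 1, integration in l gives O(N² ν_k⁻² s⁻¹ Λⁿ e^{-sΛ/2}). Finally |l| ≤ 1
forces ν_k > Λ-1, so the sum of ν_k⁻² gains a factor 1/Λ, which yields Λ^{n-1} = Λ^{(Q-4)/2}. The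
pointwise part is `norm_tailIntegrand_le`, the integral `integral_tailMajorant`, the sum
`sum_inv_sq_le`.

The coefficient formula needs care, as the heat kernel is defined by a Laguerre series in |l|. The
Laguerre generating function sums the series to a closed form that extends smoothly across l = 0;
multiplied by the compactly supported symbol it is a Schwartz function of l, so Fourier inversion
applies. The radial integral is then a Laplace transform of a Laguerre polynomial
(`integral_laguerreL_mul_exp`), and no sum and integral have to be exchanged there. Continuity of
σ̂(l)Φ_α^l for l ≠ 0 serves only to make the integrand measurable. -/

noncomputable section

namespace HeisenbergDiscrepancy

open scoped FourierTransform ContDiff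

/-! ### The Fourier transform of the cutoff -/

/-- The complex valued Schwartz function `x ↦ Ψ(2πx)`. -/
def dilated (Ψ : 𝓢(ℝ, ℝ)) : 𝓢(ℝ, ℂ) :=
  compCLMOfContinuousLinearEquiv ℂ
    (ContinuousLinearEquiv.unitsEquivAut ℝ (Units.mk0 (2 * Real.pi) Real.two_pi_pos.ne'))
    (postcompCLM (𝕜 := ℝ) Complex.ofRealCLM Ψ)

theorem dilated_apply (Ψ : 𝓢(ℝ, ℝ)) (x : ℝ) : dilated Ψ x = (Ψ (2 * Real.pi * x) : ℂ) := by
  simp [dilated, mul_comm]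

/-- The inverse Fourier transform of `cutoff Ψ`, that is the self-convolution of `x ↦ Ψ(2πx)`. -/
def cutoffSymbol (Ψ : 𝓢(ℝ, ℝ)) : 𝓢(ℝ, ℂ) :=
  SchwartzMap.convolution (ContinuousLinearMap.mul ℂ ℂ) (dilated Ψ) (dilated Ψ)

/-- Reconciles the kernel e^{-ilt} dl/2π of the definitions with the kernel e^{-2πixt} dx of `𝓕`. -/
theorem fourier_comp_two_pi_mul (f : ℝ → ℂ) (t : ℝ) :
    𝓕 (fun x => f (2 * Real.pi * x)) t =
      1 / (2 * Real.pi) * ∫ l : ℝ, f l * Complex.exp (-Complex.I * l * t) := by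
  rw [Real.fourier_real_eq_integral_exp_smul]
  have := Measure.integral_comp_mul_left
    (fun l : ℝ => f l * Complex.exp (-Complex.I * l * t)) (2 * Real.pi)
  rw [abs_of_pos (by positivity)] at this
  rw [show (1 / (2 * Real.pi : ℂ)) = (((2 * Real.pi)⁻¹ : ℝ) : ℂ) by push_cast; ring,
    ← Complex.real_smul, ← this]
  refine integral_congr_ae (Filter.Eventually.of_forall fun x => ?_)
  simp only [smul_eq_mul]
  rw [mul_comm]
  congr 2
  push_cast
  ring

theorem cutoff_eq_fourier (Ψ : 𝓢(ℝ, ℝ)) (t : ℝ) : cutoff Ψ t = 𝓕 (cutoffSymbol Ψ) t := by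
  have h : 𝓕 (dilated Ψ) t =
      1 / (2 * Real.pi) * ∫ l : ℝ, (Ψ l : ℂ) * Complex.exp (-Complex.I * l * t) := by
    rw [← fourier_comp_two_pi_mul (fun l => (Ψ l : ℂ)), fourier_coe]
    exact congrArg (fun f : ℝ → ℂ => 𝓕 f t) (funext (dilated_apply Ψ))
  simp [cutoff, cutoffSymbol, fourier_convolution, h, sq]

theorem cutoffSymbol_apply (Ψ : 𝓢(ℝ, ℝ)) (x : ℝ) :
    cutoffSymbol Ψ x =
      ((∫ y, Ψ (2 * Real.pi * y) * Ψ (2 * Real.pi * (x - y)) : ℝ) : ℂ) := by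
  rw [cutoffSymbol, SchwartzMap.convolution_apply, MeasureTheory.convolution, ← integral_complex_ofReal]
  simp [dilated_apply]

/-- If |2πx| > 1, then 2πy and 2π(x - y) cannot both lie in [-1/2, 1/2], so the convolution
integrand vanishes identically. -/
theorem cutoffSymbol_eq_zero {Ψ : 𝓢(ℝ, ℝ)} (hΨ : tsupport Ψ ⊆ Set.Icc (-(1 / 2)) (1 / 2))
    {x : ℝ} (hx : 1 < |2 * Real.pi * x|) : cutoffSymbol Ψ x = 0 := by
  have h0 : ∀ u, 1 / 2 < |u| → Ψ u = 0 := by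
    intro u hu
    by_contra h
    have := hΨ (subset_tsupport _ h)
    rw [Set.mem_Icc, ← abs_le] at this
    linarith
  rw [cutoffSymbol_apply, Complex.ofReal_eq_zero]
  refine integral_eq_zero_of_ae (Filter.Eventually.of_forall fun y => ?_)
  by_cases hy : 1 / 2 < |2 * Real.pi * y|
  · simp [h0 _ hy]
  · have := abs_sub_abs_le_abs_sub (2 * Real.pi * x) (2 * Real.pi * y)
    rw [← mul_sub] at this
    simp [h0 (2 * Real.pi * (x - y)) (by linarith)]

theorem hasCompactSupport_cutoffSymbol {Ψ : 𝓢(ℝ, ℝ)}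
    (hΨ : tsupport Ψ ⊆ Set.Icc (-(1 / 2)) (1 / 2)) : HasCompactSupport (cutoffSymbol Ψ) := by
  refine HasCompactSupport.of_support_subset_isCompact
    (isCompact_Icc (a := -(2 * Real.pi)⁻¹) (b := (2 * Real.pi)⁻¹)) fun x hx => ?_
  by_contra h
  refine hx (cutoffSymbol_eq_zero hΨ ?_)
  rw [Set.mem_Icc, ← abs_le, not_le] at h
  rw [abs_mul, abs_of_pos Real.two_pi_pos]
  exact (inv_lt_iff_one_lt_mul₀' Real.two_pi_pos).1 h

/-- The inequality |ab| ≤ (a² + b²)/2 suffices, since after the dilation by 2π each of the two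
squares has integral 1. -/
theorem norm_cutoffSymbol_le_one {Ψ : 𝓢(ℝ, ℝ)} (hΨ : (∫ x : ℝ, Ψ x ^ 2) = 2 * Real.pi) (x : ℝ) :
    ‖cutoffSymbol Ψ x‖ ≤ 1 := by
  have hint : Integrable fun y : ℝ => Ψ y ^ 2 := by
    have := (Ψ.memLp 2 volume).integrable_sq
    simpa using this
  have h1 : Integrable fun y : ℝ => Ψ (2 * Real.pi * y) ^ 2 :=
    hint.comp_mul_left' Real.two_pi_pos.ne'
  have h2 : Integrable fun y : ℝ => Ψ (2 * Real.pi * (x - y)) ^ 2 := h1.comp_sub_left x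
  have e1 : ∫ y : ℝ, Ψ (2 * Real.pi * y) ^ 2 = 1 := by
    rw [Measure.integral_comp_mul_left (fun y => Ψ y ^ 2), hΨ, abs_of_pos (by positivity),
      smul_eq_mul, inv_mul_cancel₀ Real.two_pi_pos.ne']
  have e2 : ∫ y : ℝ, Ψ (2 * Real.pi * (x - y)) ^ 2 = 1 := by
    rw [integral_sub_left_eq_self (fun y => Ψ (2 * Real.pi * y) ^ 2) volume x, e1]
  rw [cutoffSymbol_apply, Complex.norm_real]
  refine (norm_integral_le_of_norm_le (h1.add h2 |>.const_mul (1 / 2))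
    (Filter.Eventually.of_forall fun y => ?_)).trans_eq ?_
  · rw [norm_mul, Real.norm_eq_abs, Real.norm_eq_abs]
    have := two_mul_le_add_sq |Ψ (2 * Real.pi * y)| |Ψ (2 * Real.pi * (x - y))|
    simp only [sq_abs] at this
    simp only [Pi.add_apply]
    linarith
  · rw [integral_const_mul]
    simp only [Pi.add_apply]
    rw [integral_add h1 h2, e1, e2]
    norm_num

/-- The convolution of the Fourier transforms of `χ` and `Q` is the Fourier transform of `χ Q`. -/
theorem integral_fourier_sub_mul_fourier (χ : 𝓢(ℝ, ℂ)) {Q : ℝ → ℂ} (hQ : Integrable Q) (t : ℝ) :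
    ∫ τ : ℝ, 𝓕 χ (t - τ) * 𝓕 Q τ = 𝓕 (fun x => χ x * Q x) t := by
  have hF : Integrable fun τ : ℝ => 𝓕 χ (t - τ) := (𝓕 χ).integrable.comp_sub_left t
  -- The multiplication formula moves the transform from `Q` to the reflected translate of `𝓕 χ`,
  -- which inversion evaluates. Integrability of `𝓕 Q` is never required.
  have key := VectorFourier.integral_fourierIntegral_smul_eq_flip (e := 𝐞) (L := innerₗ ℝ)
    Real.continuous_fourierChar continuous_inner hF hQ
  have h2 : ∀ x, 𝓕 (fun τ => 𝓕 χ (t - τ)) x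
      = Complex.exp (((-2 * Real.pi * x * t : ℝ) : ℂ) * Complex.I) * χ x := by
    intro x
    have e : χ x = 𝓕⁻ (𝓕 χ) x := by simp
    rw [e, fourierInv_coe, Real.fourier_real_eq_integral_exp_smul, Real.fourierInv_eq',
      ← integral_const_mul, ← integral_sub_left_eq_self _ volume t]
    refine integral_congr_ae (Filter.Eventually.of_forall fun τ => ?_)
    simp only [smul_eq_mul, sub_sub_cancel, RCLike.inner_apply, conj_trivial]
    rw [← mul_assoc, ← Complex.exp_add]
    congr 2
    push_cast
    ring
  rw [Real.fourier_real_eq_integral_exp_smul]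
  rw [flip_innerₗ] at key
  change ∫ ξ : ℝ, 𝓕 (fun τ => 𝓕 χ (t - τ)) ξ • Q ξ = ∫ x : ℝ, 𝓕 χ (t - x) • 𝓕 Q x at key
  simp only [smul_eq_mul] at key
  rw [← key]
  refine integral_congr_ae (Filter.Eventually.of_forall fun x => ?_)
  simp only [h2, smul_eq_mul]
  push_cast
  ring_nf

/-- Smoothness and compact support make `g` a Schwartz function, so this is Fourier inversion at
l/2π. -/
theorem integral_fourier_mul_exp {g : ℝ → ℂ} (hg : HasCompactSupport g) (hs : ContDiff ℝ ∞ g)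
    (l : ℝ) : ∫ t : ℝ, 𝓕 g t * Complex.exp (Complex.I * l * t) = g (l / (2 * Real.pi)) := by
  have h : 𝓕⁻ (𝓕 (hg.toSchwartzMap hs)) (l / (2 * Real.pi)) = g (l / (2 * Real.pi)) := by
    simp
  rw [← h, fourierInv_coe, Real.fourierInv_eq']
  refine integral_congr_ae (Filter.Eventually.of_forall fun t => ?_)
  simp only [smul_eq_mul, RCLike.inner_apply, conj_trivial]
  rw [mul_comm, fourier_coe]
  congr 2
  have := Real.pi_ne_zero
  push_cast
  field_simp

/-! ### Generating function and weighted integrals of Laguerre polynomials -/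

/-- Writing k = i + m turns the series into a double series over (i, m). The sum over m is a
negative binomial series with value (1 - r)^{-(i+δ+1)}; the sum over i is then an exponential
series. -/
theorem hasSum_laguerreL (δ : ℕ) (u : ℝ) {r : ℝ} (h0 : 0 ≤ r) (h1 : r < 1) :
    HasSum (fun k => r ^ k * laguerreL δ k u)
      (((1 - r) ^ (δ + 1))⁻¹ * Real.exp (-(u * r / (1 - r)))) := by
  have hr : ‖r‖ < 1 := by rwa [Real.norm_of_nonneg h0]
  have hr' : 0 < 1 - r := by linarith
  set f : ℝ → ℕ × ℕ → ℝ := fun v p =>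
    v ^ p.1 / (p.1.factorial : ℝ) * r ^ p.1 * (((p.2 + (p.1 + δ)).choose (p.1 + δ) : ℝ) * r ^ p.2)
    with hf
  have inner : ∀ v i, HasSum (fun m => f v (i, m))
      (((1 - r) ^ (δ + 1))⁻¹ * ((v * r / (1 - r)) ^ i / (i.factorial : ℝ))) := by
    intro v i
    have := (hasSum_choose_mul_geometric_of_norm_lt_one (i + δ) hr).mul_left
      (v ^ i / (i.factorial : ℝ) * r ^ i)
    convert! this using 1
    rw [div_pow, mul_pow, add_assoc, pow_add (1 - r) i]
    field_simp
  have outer : ∀ v, HasSum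
      (fun i : ℕ => ((1 - r) ^ (δ + 1))⁻¹ * ((v * r / (1 - r)) ^ i / (i.factorial : ℝ)))
      (((1 - r) ^ (δ + 1))⁻¹ * Real.exp (v * r / (1 - r))) := fun v => by
    rw [Real.exp_eq_exp_ℝ]
    exact (NormedSpace.expSeries_div_hasSum_exp (v * r / (1 - r))).mul_left _
  -- The terms of `f |u|` are the absolute values of those of `f (-u)`, so the same two summations
  -- prove absolute convergence and permit regrouping along antidiagonals.
  have habs : Summable (f |u|) := by
    rw [summable_prod_of_nonneg fun p => by simp only [hf, Pi.zero_apply]; positivity]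
    refine ⟨fun i => (inner _ i).summable, ?_⟩
    simp only [(inner _ _).tsum_eq]
    exact (outer _).summable
  have hsum : Summable (f (-u)) := by
    refine Summable.of_norm (habs.congr fun p => ?_)
    simp [hf, abs_of_nonneg h0]
  have hS : HasSum (f (-u)) (((1 - r) ^ (δ + 1))⁻¹ * Real.exp (-u * r / (1 - r))) := by
    rw [← (outer _).tsum_eq]
    simp only [← (inner _ _).tsum_eq]
    rw [← hsum.tsum_prod]
    exact hsum.hasSum
  have := ((Equiv.hasSum_iff Finset.HasAntidiagonal.sigmaAntidiagonalEquivProd).2 hS).sigma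
    (g := fun k => r ^ k * laguerreL δ k u) fun k => ?_
  · convert! this using 3
    ring
  · convert! hasSum_fintype _ using 1
    simp only [Function.comp, Finset.HasAntidiagonal.sigmaAntidiagonalEquivProd_apply]
    rw [Finset.univ_eq_attach, Finset.sum_attach _ (f (-u)),
      Finset.Nat.sum_antidiagonal_eq_sum_range_succ_mk, laguerreL, Finset.mul_sum]
    refine Finset.sum_congr rfl fun i hi => ?_
    have hi' : i ≤ k := by simpa [Nat.lt_succ_iff] using hi
    have e1 : k - i + (i + δ) = k + δ := by omega
    have e2 : (k + δ).choose (i + δ) = (k + δ).choose (k - i) := by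
      rw [← Nat.choose_symm_of_eq_add (by omega : k + δ = (k - i) + (i + δ))]
    simp only [hf, e1, e2]
    rw [neg_pow, show r ^ k = r ^ i * r ^ (k - i) by rw [← pow_add]; congr 1; omega]
    ring

theorem integral_pow_mul_exp_neg_mul_sq (m : ℕ) {b : ℝ} (hb : 0 < b) :
    ∫ r in Set.Ioi (0 : ℝ), r ^ (2 * m + 1) * Real.exp (-b * r ^ 2) =
      (m.factorial : ℝ) / (2 * b ^ (m + 1)) := by
  have := integral_rpow_mul_exp_neg_mul_rpow (p := 2) (q := (2 * m + 1 : ℕ)) (b := b) two_pos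
    (by have : (0 : ℝ) ≤ (2 * m + 1 : ℕ) := Nat.cast_nonneg _
        linarith) hb
  simp only [Real.rpow_natCast, Real.rpow_two] at this
  rw [this]
  have e : (((2 * m + 1 : ℕ) : ℝ) + 1) / 2 = (m : ℝ) + 1 := by push_cast; ring
  rw [neg_div, e, Real.Gamma_nat_eq_factorial, Real.rpow_neg hb.le,
    show ((m : ℝ) + 1) = ((m + 1 : ℕ) : ℝ) by push_cast; ring, Real.rpow_natCast]
  field_simp

theorem integrableOn_pow_mul_exp_neg_mul_sq (m : ℕ) {b : ℝ} (hb : 0 < b) :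
    IntegrableOn (fun r : ℝ => r ^ m * Real.exp (-b * r ^ 2)) (Set.Ioi 0) := by
  have := integrableOn_rpow_mul_exp_neg_mul_rpow (p := 2) (s := (m : ℝ)) (b := b)
    (by have : (0 : ℝ) ≤ m := Nat.cast_nonneg _
        linarith) two_pos hb
  simpa only [Real.rpow_natCast, Real.rpow_two] using this

/-- Monomials integrate to factorials, which cancel against the Laguerre coefficients and leave the
binomial expansion of (1 - (1 - ρ))^k. With ρ = e^{-2|l|s} the power ρ^k is the decay in k of the
heat semigroup. -/
theorem integral_laguerreL_mul_exp (δ k : ℕ) (ρ : ℝ) {b : ℝ} (hb : 0 < b) :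
    ∫ r in Set.Ioi (0 : ℝ),
      laguerreL δ k (b * (1 - ρ) * r ^ 2) * Real.exp (-b * r ^ 2) * r ^ (2 * δ + 1) =
      ((k + δ).factorial : ℝ) / (k.factorial : ℝ) * ρ ^ k / (2 * b ^ (δ + 1)) := by
  set c : ℕ → ℝ := fun i => (-1) ^ i * ((k + δ).choose (k - i) : ℝ) / (i.factorial : ℝ) *
    (b * (1 - ρ)) ^ i with hc
  have e : ∀ r : ℝ,
      laguerreL δ k (b * (1 - ρ) * r ^ 2) * Real.exp (-b * r ^ 2) * r ^ (2 * δ + 1) =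
      ∑ i ∈ Finset.range (k + 1),
        c i * (r ^ (2 * (δ + i) + 1) * Real.exp (-b * r ^ 2)) := by
    intro r
    rw [laguerreL, Finset.sum_mul, Finset.sum_mul]
    refine Finset.sum_congr rfl fun i _ => ?_
    simp only [hc]
    rw [mul_pow _ (r ^ 2)]
    ring
  simp only [e]
  rw [integral_finsetSum _ fun i _ =>
    (integrableOn_pow_mul_exp_neg_mul_sq (2 * (δ + i) + 1) hb).const_mul (c i)]
  simp only [integral_const_mul, integral_pow_mul_exp_neg_mul_sq _ hb]
  have hρ : ρ ^ k = (-(1 - ρ) + 1) ^ k := by ring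
  rw [hρ, add_pow, Finset.mul_sum, Finset.sum_div]
  refine Finset.sum_congr rfl fun i hi => ?_
  have hi' : i ≤ k := by simpa [Nat.lt_succ_iff] using hi
  have e1 : ((k + δ).choose (k - i) : ℝ) =
      ((k + δ).factorial : ℝ) / ((k - i).factorial * (δ + i).factorial) := by
    rw [Nat.cast_choose ℝ (by omega : k - i ≤ k + δ)]
    congr 4
    omega
  simp only [hc]
  rw [e1, Nat.cast_choose ℝ hi', neg_pow (1 - ρ), mul_pow]
  have := Nat.factorial_ne_zero
  field_simp
  ring

/-! ### The hyperbolic cardinal sine -/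

/-- The function `sinh x / x`, extended by continuity at `0`. -/
def sinhc (x : ℝ) : ℝ := dslope Real.sinh 0 x

theorem sinhc_of_ne {x : ℝ} (hx : x ≠ 0) : sinhc x = Real.sinh x / x := by
  simp [sinhc, dslope_of_ne _ hx, slope_def_field]

theorem sinhc_zero : sinhc 0 = 1 := by
  simp [sinhc, dslope_same]

theorem sinhc_neg (x : ℝ) : sinhc (-x) = sinhc x := by
  rcases eq_or_ne x 0 with rfl | hx
  · simp
  · rw [sinhc_of_ne hx, sinhc_of_ne (neg_ne_zero.2 hx), Real.sinh_neg, neg_div_neg_eq]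

theorem sinhc_abs (x : ℝ) : sinhc |x| = sinhc x := by
  rcases abs_choice x with h | h <;> simp [h, sinhc_neg]

theorem contDiff_sinhc : ContDiff ℝ ∞ sinhc := by
  rw [contDiff_iff_contDiffAt]
  intro x
  have hs : ∀ y, AnalyticAt ℝ Real.sinh y := fun y => Real.analyticAt_sinh
  rcases eq_or_ne x 0 with rfl | hx
  · obtain ⟨p, hp⟩ := hs 0
    exact (hp.has_fpower_series_dslope_fslope.analyticAt).contDiffAt
  · refine ContDiffAt.congr_of_eventuallyEq
      (((hs x).contDiffAt).div contDiffAt_id hx) ?_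
    filter_upwards [isOpen_ne.mem_nhds hx] with y hy
    exact sinhc_of_ne hy

/-- Half-angle formulas give sinh y = 2 sinh(y/2) cosh(y/2) ≥ y(1 + 2 sinh²(y/4)), and sinh(y/4) ≥
y/4. Quadratic growth is enough for integrability of `heatSymbol`. -/
theorem one_add_sq_div_eight_le_sinhc (x : ℝ) : 1 + x ^ 2 / 8 ≤ sinhc x := by
  rw [← sinhc_abs, ← sq_abs]
  rcases eq_or_ne x 0 with rfl | hx
  · simp [sinhc_zero]
  have h0 : 0 < |x| := abs_pos.2 hx
  generalize |x| = y at h0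
  rw [sinhc_of_ne h0.ne', le_div_iff₀ h0]
  have h2 : Real.sinh y = 2 * Real.sinh (y / 2) * Real.cosh (y / 2) := by
    rw [← Real.sinh_two_mul]
    congr 1
    ring
  have h4 : Real.cosh (y / 2) = 1 + 2 * Real.sinh (y / 4) ^ 2 := by
    have := Real.cosh_two_mul (y / 4)
    rw [Real.cosh_sq, show 2 * (y / 4) = y / 2 by ring] at this
    linarith
  have a1 : y / 2 ≤ Real.sinh (y / 2) := Real.self_le_sinh_iff.2 (by positivity)
  have a2 : y / 4 ≤ Real.sinh (y / 4) := Real.self_le_sinh_iff.2 (by positivity)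
  have a3 : 1 + y ^ 2 / 8 ≤ Real.cosh (y / 2) := by
    have := pow_le_pow_left₀ (by positivity) a2 2
    rw [h4]
    nlinarith
  have := mul_le_mul a1 a3 (by positivity) (by linarith)
  rw [h2]
  nlinarith

theorem sinhc_pos (x : ℝ) : 0 < sinhc x :=
  lt_of_lt_of_le (by positivity) (one_add_sq_div_eight_le_sinhc x)

/-! ### The heat kernel on the Fourier side -/

/-- The generating function at r = e^{-2|l|s}. The exponent is left split so that the growing factor
e^{|l|‖z‖²/4} can later cancel the decay of the Laguerre function and leave a single Gaussian. -/
theorem heatFourier_eq_exp {n : ℕ} [NeZero n] {s l : ℝ} (hs : 0 < s) (hl : l ≠ 0)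
    (z : EuclideanSpace ℂ (Fin n)) :
    heatFourier s l z =
      (Real.exp (-(|l| * s)) * (|l| / (2 * Real.pi)) / (1 - Real.exp (-(2 * |l| * s)))) ^ n *
        Real.exp (1 / 4 * |l| * ‖z‖ ^ 2 -
          |l| / (2 * (1 - Real.exp (-(2 * |l| * s)))) * ‖z‖ ^ 2) := by
  have hl' : 0 < |l| := abs_pos.2 hl
  have hx : -(2 * |l| * s) < 0 := by
    have : 0 < 2 * |l| * s := by positivity
    linarith
  set r := Real.exp (-(2 * |l| * s)) with hr
  have hr1 : r < 1 := Real.exp_lt_one_iff.2 hx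
  have hr' : 1 - r ≠ 0 := by linarith
  have hS := (hasSum_laguerreL (n - 1) (1 / 2 * |l| * ‖z‖ ^ 2) (Real.exp_pos _).le hr1).mul_left
    (Real.exp (-(|l| * s)) ^ n * (|l| / (2 * Real.pi)) ^ n *
      Real.exp (-(1 / 4) * |l| * ‖z‖ ^ 2))
  rw [Nat.sub_add_cancel (NeZero.one_le (n := n))] at hS
  rw [heatFourier]
  convert! hS.tsum_eq using 1
  · congr 1
    ext k
    rw [laguerreScaled, ← Real.exp_nat_mul, ← Real.exp_nat_mul]
    rw [show -(2 * (k : ℝ) + n) * |l| * s = n * -(|l| * s) + k * -(2 * |l| * s) by ring,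
      Real.exp_add]
    ring
  · rw [show 1 / 4 * |l| * ‖z‖ ^ 2 - |l| / (2 * (1 - r)) * ‖z‖ ^ 2 =
      -(1 / 4) * |l| * ‖z‖ ^ 2 + -(1 / 2 * |l| * ‖z‖ ^ 2 * r / (1 - r)) by field_simp; ring,
      Real.exp_add, div_pow, mul_pow]
    ring

/-- The smooth extension of `l ↦ heatFourier s l z` to `l = 0`, where `ρ = ‖z‖`. -/
def heatSymbol (n : ℕ) (s ρ l : ℝ) : ℝ :=
  (4 * Real.pi * s * sinhc (l * s))⁻¹ ^ n *
    Real.exp (-(ρ ^ 2 * Real.cosh (l * s) / (4 * s * sinhc (l * s))))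

/-- At l = 0 the series vanishes while the symbol is positive, so l ≠ 0 is essential; a single point
does not affect the integrals. -/
theorem heatFourier_eq_heatSymbol {n : ℕ} [NeZero n] {s l : ℝ} (hs : 0 < s) (hl : l ≠ 0)
    (z : EuclideanSpace ℂ (Fin n)) : heatFourier s l z = heatSymbol n s ‖z‖ l := by
  have hl' : 0 < |l| := abs_pos.2 hl
  have hx : 0 < |l| * s := by positivity
  have e1 : sinhc (l * s) = Real.sinh (|l| * s) / (|l| * s) := by
    rw [← sinhc_abs, abs_mul, abs_of_pos hs, sinhc_of_ne hx.ne']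
  have e2 : Real.cosh (l * s) = Real.cosh (|l| * s) := by
    rw [← Real.cosh_abs, abs_mul, abs_of_pos hs]
  rw [heatFourier_eq_exp hs hl, heatSymbol, e1, e2, Real.sinh_eq, Real.cosh_eq,
    show -(2 * |l| * s) = -(|l| * s) + -(|l| * s) by ring, Real.exp_add]
  have hE : Real.exp (|l| * s) = (Real.exp (-(|l| * s)))⁻¹ := by rw [Real.exp_neg, inv_inv]
  have hE1 : Real.exp (-(|l| * s)) < 1 := Real.exp_lt_one_iff.2 (by linarith)
  have hE0 := Real.exp_pos (-(|l| * s))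
  rw [hE]
  set E := Real.exp (-(|l| * s))
  have h1 : 1 - E ^ 2 ≠ 0 := by nlinarith
  have h2 : E⁻¹ - E ≠ 0 := by
    rw [show E⁻¹ - E = (1 - E ^ 2) / E by field_simp]
    positivity
  have h3 : E⁻¹ - E = (1 - E ^ 2) / E := by field_simp
  have h4 : E⁻¹ + E = (1 + E ^ 2) / E := by field_simp
  rw [h3, h4, ← sq]
  have hpi := Real.pi_pos
  congr 2
  · field_simp
    ring
  · field_simp
    ring

theorem contDiff_heatSymbol (n : ℕ) {s : ℝ} (hs : 0 < s) (ρ : ℝ) :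
    ContDiff ℝ ∞ (heatSymbol n s ρ) := by
  have h1 : ContDiff ℝ ∞ fun l : ℝ => sinhc (l * s) :=
    contDiff_sinhc.comp (contDiff_id.mul contDiff_const)
  have h2 : ContDiff ℝ ∞ fun l : ℝ => Real.cosh (l * s) :=
    Real.contDiff_cosh.comp (contDiff_id.mul contDiff_const)
  have hpi := Real.pi_pos
  refine ContDiff.mul (ContDiff.pow (ContDiff.inv (contDiff_const.mul h1) fun l => ?_) n)
    (ContDiff.exp (ContDiff.neg (ContDiff.div (contDiff_const.mul h2) (contDiff_const.mul h1)
      fun l => ?_)))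
  · have := sinhc_pos (l * s)
    positivity
  · have := sinhc_pos (l * s)
    positivity

/-- The Gaussian factor is at most 1, and one of the n ≥ 1 powers of 1/sinhc already gives the
majorant 1/(1 + (sl/3)²), since 1/9 ≤ 1/8. -/
theorem integrable_heatSymbol (n : ℕ) [NeZero n] {s : ℝ} (hs : 0 < s) (ρ : ℝ) :
    Integrable (heatSymbol n s ρ) := by
  have hpi := Real.pi_pos
  have hg : Integrable fun l : ℝ =>
      (4 * Real.pi * s)⁻¹ ^ n * (1 + (s / 3 * l) ^ 2)⁻¹ :=
    (integrable_inv_one_add_sq.comp_mul_left' (by positivity : s / 3 ≠ 0)).const_mul _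
  refine hg.mono' (contDiff_heatSymbol n hs ρ).continuous.aestronglyMeasurable
    (Filter.Eventually.of_forall fun l => ?_)
  have h0 := sinhc_pos (l * s)
  have h1 := one_add_sq_div_eight_le_sinhc (l * s)
  have hc := Real.cosh_pos (l * s)
  rw [Real.norm_of_nonneg (by unfold heatSymbol; positivity), heatSymbol, mul_inv, mul_pow,
    mul_assoc]
  gcongr
  have h2 : 1 + (s / 3 * l) ^ 2 ≤ sinhc (l * s) := by nlinarith [sq_nonneg (l * s)]
  have h3 : 1 ≤ sinhc (l * s) := by nlinarith [sq_nonneg (l * s)]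
  calc (sinhc (l * s))⁻¹ ^ n * Real.exp _ ≤ (sinhc (l * s))⁻¹ ^ n * 1 := by
        gcongr
        rw [Real.exp_le_one_iff, neg_nonpos]
        positivity
    _ ≤ (sinhc (l * s))⁻¹ ^ 1 := by
        rw [mul_one]
        exact pow_le_pow_of_le_one (by positivity) (inv_le_one_of_one_le₀ h3) NeZero.one_le
    _ ≤ (1 + (s / 3 * l) ^ 2)⁻¹ := by
        rw [pow_one]
        gcongr

/-! ### The Fourier coefficients of `K_s` -/

theorem heatKernel_eq_fourier {n : ℕ} [NeZero n] {s : ℝ} (hs : 0 < s)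
    (z : EuclideanSpace ℂ (Fin n)) (τ : ℝ) :
    heatKernel s (z, τ) =
      𝓕 (fun x : ℝ => (heatSymbol n s ‖z‖ (2 * Real.pi * x) : ℂ)) τ := by
  rw [fourier_comp_two_pi_mul (fun l => (heatSymbol n s ‖z‖ l : ℂ)), heatKernel]
  congr 1
  refine integral_congr_ae ?_
  filter_upwards [compl_mem_ae_iff.2 (measure_singleton (0 : ℝ))] with l hl
  rw [heatFourier_eq_heatSymbol hs hl]

theorem kernelK_eq_fourier {n : ℕ} [NeZero n] (Ψ : 𝓢(ℝ, ℝ)) {s : ℝ} (hs : 0 < s)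
    (z : EuclideanSpace ℂ (Fin n)) (t : ℝ) :
    kernelK Ψ s (z, t) =
      𝓕 (fun x : ℝ => cutoffSymbol Ψ x * (heatSymbol n s ‖z‖ (2 * Real.pi * x) : ℂ)) t := by
  rw [← integral_fourier_sub_mul_fourier, kernelK]
  · simp only [cutoff_eq_fourier, heatKernel_eq_fourier hs]
  · exact ((integrable_heatSymbol n hs ‖z‖).comp_mul_left' Real.two_pi_pos.ne').ofReal

theorem integral_kernelK_mul_exp {n : ℕ} [NeZero n] {Ψ : 𝓢(ℝ, ℝ)}
    (hΨ : tsupport Ψ ⊆ Set.Icc (-(1 / 2)) (1 / 2)) {s : ℝ} (hs : 0 < s)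
    (z : EuclideanSpace ℂ (Fin n)) (l : ℝ) :
    ∫ t : ℝ, kernelK Ψ s (z, t) * Complex.exp (Complex.I * l * t) =
      cutoffSymbol Ψ (l / (2 * Real.pi)) * (heatSymbol n s ‖z‖ l : ℂ) := by
  simp only [kernelK_eq_fourier Ψ hs]
  rw [integral_fourier_mul_exp]
  · rw [mul_div_cancel₀ _ Real.two_pi_pos.ne']
  · exact (hasCompactSupport_cutoffSymbol hΨ).mul_right
  · exact (cutoffSymbol Ψ).smooth'.mul (Complex.ofRealCLM.contDiff.comp
      ((contDiff_heatSymbol n hs ‖z‖).comp (contDiff_const.mul contDiff_id)))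

theorem laguerreNorm_sq (δ k : ℕ) :
    laguerreNorm δ k ^ 2 = (k.factorial : ℝ) / ((k + δ).factorial : ℝ) := by
  have : Real.Gamma ((k : ℝ) + δ + 1) = ((k + δ).factorial : ℝ) := by
    rw [← Real.Gamma_nat_eq_factorial]
    push_cast
    rfl
  rw [laguerreNorm, this, Real.sq_sqrt (by positivity)]

/-- The value of the normalizing constant in `radialCoeff_kernelK`. -/
def coeffConst (n : ℕ) : ℝ := (1 / 2 : ℝ) ^ (((n - 1 : ℕ) : ℝ) / 2) / (2 * Real.pi ^ n)

/-- Inversion in t replaces the inner integral by symbol times closed-form heat kernel. What remains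
is the Laplace transform of a Laguerre polynomial with b = |l|/(2(1 - r)), chosen so that b(1 - r) =
|l|/2; the powers of |l| and 1 - r then cancel. -/
theorem radialCoeff_kernelK {n : ℕ} [NeZero n] {Ψ : 𝓢(ℝ, ℝ)}
    (hΨ : tsupport Ψ ⊆ Set.Icc (-(1 / 2)) (1 / 2)) {s : ℝ} (hs : 0 < s) {l : ℝ} (hl : l ≠ 0)
    (k : ℕ) :
    radialCoeff (kernelK (n := n) Ψ s) l k =
      cutoffSymbol Ψ (l / (2 * Real.pi)) *
        ((coeffConst n * Real.exp (-(2 * k + n) * |l| * s) : ℝ) : ℂ) := by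
  have hl' : 0 < |l| := abs_pos.2 hl
  have hpi := Real.pi_pos
  have hn : n - 1 + 1 = n := Nat.sub_add_cancel NeZero.one_le
  set δ := n - 1 with hδ
  have hnδ : (n : ℝ) = δ + 1 := by rw [← hn]; push_cast; rfl
  set r := Real.exp (-(2 * |l| * s)) with hr
  have hr1 : r < 1 := Real.exp_lt_one_iff.2 (by
    have : 0 < 2 * |l| * s := by positivity
    linarith)
  have hr' : 0 < 1 - r := by linarith
  set b := |l| / (2 * (1 - r)) with hb
  have hb0 : 0 < b := by positivity
  set A : ℝ := (Real.exp (-(|l| * s)) * (|l| / (2 * Real.pi)) / (1 - r)) ^ n with hA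
  set c : ℝ := A * laguerreNorm δ k * (1 / 2 : ℝ) ^ ((δ : ℝ) / 2) with hc
  have hint : ∀ x ∈ Set.Ioi (0 : ℝ),
      (∫ t : ℝ, radialProfile (kernelK (n := n) Ψ s) x t * Complex.exp (Complex.I * l * t)) *
      (((|l| * x ^ 2) ^ ((1 - (n : ℝ)) / 2) * laguerreFun δ k (1 / 2 * |l| * x ^ 2) *
        x ^ (2 * n - 1) : ℝ) : ℂ) =
      cutoffSymbol Ψ (l / (2 * Real.pi)) * ((c * (laguerreL δ k (b * (1 - r) * x ^ 2) *
        Real.exp (-b * x ^ 2) * x ^ (2 * δ + 1)) : ℝ) : ℂ) := by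
    intro x hx
    have hx : 0 < x := hx
    simp only [radialProfile]
    rw [integral_kernelK_mul_exp hΨ hs, mul_assoc, ← heatFourier_eq_heatSymbol hs hl,
      heatFourier_eq_exp hs hl, ← Complex.ofReal_mul]
    have hnorm : ‖(EuclideanSpace.single 0 (x : ℂ) : EuclideanSpace ℂ (Fin n))‖ = x := by
      simp [abs_of_pos hx]
    rw [hnorm]
    congr 2
    have e1 : b * (1 - r) * x ^ 2 = 1 / 2 * |l| * x ^ 2 := by
      rw [hb]; field_simp
    have e2 : (|l| * x ^ 2) ^ ((1 - (n : ℝ)) / 2) * (1 / 2 * |l| * x ^ 2) ^ ((δ : ℝ) / 2) =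
        (1 / 2 : ℝ) ^ ((δ : ℝ) / 2) := by
      rw [mul_assoc (1 / 2 : ℝ), Real.mul_rpow (x := 1 / 2) (by norm_num) (by positivity),
        mul_left_comm, ← Real.rpow_add (by positivity), hnδ]
      rw [show (1 - ((δ : ℝ) + 1)) / 2 + δ / 2 = 0 by ring, Real.rpow_zero, mul_one]
    have e3 : Real.exp (1 / 4 * |l| * x ^ 2 - b * x ^ 2) * Real.exp (-(1 / 2 * |l| * x ^ 2) / 2) =
        Real.exp (-b * x ^ 2) := by
      rw [← Real.exp_add]
      congr 1
      ring
    have e4 : 2 * n - 1 = 2 * δ + 1 := by omega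
    rw [laguerreFun, e1, e4, hc, ← e2, ← e3]
    ring
  rw [radialCoeff, setIntegral_congr_fun measurableSet_Ioi hint, integral_const_mul,
    integral_complex_ofReal, integral_const_mul, integral_laguerreL_mul_exp δ k r hb0, hn,
    mul_left_comm, ← Complex.ofReal_mul]
  congr 2
  have hE : Real.exp (-(2 * (k : ℝ) + n) * |l| * s) = Real.exp (-(|l| * s)) ^ n * r ^ k := by
    rw [hr, ← Real.exp_nat_mul, ← Real.exp_nat_mul, ← Real.exp_add]
    congr 1
    ring
  have hL := laguerreNorm_sq δ k
  have hb' : b ^ n = |l| ^ n / (2 ^ n * (1 - r) ^ n) := by rw [hb, div_pow, mul_pow]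
  have hA' : A = Real.exp (-(|l| * s)) ^ n * |l| ^ n / (2 ^ n * Real.pi ^ n * (1 - r) ^ n) := by
    rw [hA, div_pow, mul_pow, div_pow, mul_pow]
    field_simp
  have h1 := Nat.factorial_ne_zero k
  have h2 := Nat.factorial_ne_zero (k + δ)
  calc _ = laguerreNorm δ k ^ 2 * (A * (1 / 2 : ℝ) ^ ((δ : ℝ) / 2) *
        (((k + δ).factorial : ℝ) / (k.factorial : ℝ) * r ^ k / (2 * b ^ n))) := by
        rw [hc]; ring
    _ = _ := by
        rw [hL, hE, hb', hA', coeffConst, ← hδ]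
        field_simp

/-! ### Hermite functions are normalized and have Gaussian decay -/

open Polynomial in
/-- The polynomials `P_k` with `(d/dt)^k exp(-t²) = P_k(t) exp(-t²)`. -/
def gaussDerivPoly : ℕ → ℝ[X]
  | 0 => 1
  | k + 1 => derivative (gaussDerivPoly k) - 2 * X * gaussDerivPoly k

theorem hasDerivAt_poly_mul_gauss (P : Polynomial ℝ) (t : ℝ) :
    HasDerivAt (fun t => P.eval t * Real.exp (-t ^ 2))
      ((Polynomial.derivative P - 2 * Polynomial.X * P).eval t * Real.exp (-t ^ 2)) t := by
  have h1 : HasDerivAt (fun t : ℝ => Real.exp (-t ^ 2)) (Real.exp (-t ^ 2) * -(2 * t)) t := by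
    have := ((hasDerivAt_pow 2 t).neg).exp
    simpa using this
  refine ((P.hasDerivAt t).mul h1).congr_deriv ?_
  simp
  ring

theorem iteratedDeriv_gauss (k : ℕ) :
    iteratedDeriv k (fun u : ℝ => Real.exp (-u ^ 2)) =
      fun t => (gaussDerivPoly k).eval t * Real.exp (-t ^ 2) := by
  induction k with
  | zero => simp [gaussDerivPoly]
  | succ k ih =>
    ext t
    rw [iteratedDeriv_succ, ih, (hasDerivAt_poly_mul_gauss _ t).deriv, gaussDerivPoly]

/-- The relation H_k' = 2k H_{k-1}, for the polynomials that carry the sign (-1)^k. -/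
theorem derivative_gaussDerivPoly_succ (k : ℕ) :
    Polynomial.derivative (gaussDerivPoly (k + 1)) = -(2 * ((k + 1 : ℕ) : Polynomial ℝ)) * gaussDerivPoly k := by
  induction k with
  | zero => simp [gaussDerivPoly]
  | succ k ih =>
    have h1 : gaussDerivPoly (k + 1) =
        Polynomial.derivative (gaussDerivPoly k) - 2 * Polynomial.X * gaussDerivPoly k := rfl
    have h2 : gaussDerivPoly (k + 2) =
        -(2 * ((k + 1 : ℕ) : Polynomial ℝ)) * gaussDerivPoly k - 2 * Polynomial.X * gaussDerivPoly (k + 1) := by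
      rw [← ih]
      rfl
    have h3 : Polynomial.derivative (gaussDerivPoly (k + 2)) =
        -(2 * ((k + 1 : ℕ) : Polynomial ℝ)) * Polynomial.derivative (gaussDerivPoly k) -
          (2 * gaussDerivPoly (k + 1) +
            2 * Polynomial.X * Polynomial.derivative (gaussDerivPoly (k + 1))) := by
      rw [h2]
      simp
    rw [h3, ih]
    push_cast
    linear_combination (2 * (k + 1) : Polynomial ℝ) * h1

/-- Integration by parts moves one derivative of the Gaussian onto P_{k+1}, whose derivative is
-2(k+1)P_k. Hence each step multiplies the integral by 2(k+1). -/
theorem integral_gaussDerivPoly_sq (k : ℕ) :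
    ∫ t : ℝ, (gaussDerivPoly k ^ 2).eval t * Real.exp (-t ^ 2) =
      2 ^ k * (k.factorial : ℝ) * √Real.pi := by
  induction k with
  | zero =>
    have := integral_gaussian 1
    simpa [gaussDerivPoly] using this
  | succ k ih =>
    have hi : ∀ P Q : Polynomial ℝ, Integrable
        ((fun t => P.eval t) * fun t => Q.eval t * Real.exp (-t ^ 2)) := fun P Q => by
      refine (integrable_poly_gauss (P * Q)).congr (Filter.Eventually.of_forall fun t => ?_)
      simp [mul_assoc]
    have := integral_mul_deriv_eq_deriv_mul_of_integrable
      (fun t _ => (gaussDerivPoly (k + 1)).hasDerivAt t)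
      (fun t _ => hasDerivAt_poly_mul_gauss (gaussDerivPoly k) t) (hi _ _) (hi _ _) (hi _ _)
    rw [← gaussDerivPoly] at this
    calc _ = ∫ t : ℝ, (gaussDerivPoly (k + 1)).eval t *
          ((gaussDerivPoly (k + 1)).eval t * Real.exp (-t ^ 2)) := by
          refine integral_congr_ae (Filter.Eventually.of_forall fun t => ?_)
          simp only [Polynomial.eval_pow]
          ring
      _ = (2 * (k + 1 : ℕ)) * ∫ t : ℝ, (gaussDerivPoly k ^ 2).eval t * Real.exp (-t ^ 2) := by
          rw [this, ← integral_neg, ← integral_const_mul]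
          refine integral_congr_ae (Filter.Eventually.of_forall fun t => ?_)
          simp only [derivative_gaussDerivPoly_succ]
          simp
          ring
      _ = _ := by
          rw [ih, Nat.factorial_succ]
          push_cast
          ring

theorem hermiteFun_eq (k : ℕ) (t : ℝ) :
    hermiteFun k t = 1 / √(2 ^ k * (k.factorial : ℝ) * √Real.pi) * ((-1) ^ k *
      (gaussDerivPoly k).eval t) * Real.exp (-t ^ 2 / 2) := by
  simp only [hermiteFun, hermiteH, iteratedDeriv_gauss]
  have : Real.exp (t ^ 2) * Real.exp (-t ^ 2) = 1 := by rw [← Real.exp_add]; simp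
  linear_combination (1 / √(2 ^ k * (k.factorial : ℝ) * √Real.pi) * (-1) ^ k *
    (gaussDerivPoly k).eval t * Real.exp (-t ^ 2 / 2)) * this

theorem integral_hermiteFun_sq (k : ℕ) : ∫ t : ℝ, hermiteFun k t ^ 2 = 1 := by
  have hc : 0 < 2 ^ k * (k.factorial : ℝ) * √Real.pi := by
    have := Real.sqrt_pos.2 Real.pi_pos
    positivity
  have h : ∀ t : ℝ, hermiteFun k t ^ 2 = (2 ^ k * (k.factorial : ℝ) * √Real.pi)⁻¹ *
      ((gaussDerivPoly k ^ 2).eval t * Real.exp (-t ^ 2)) := by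
    intro t
    rw [hermiteFun_eq, mul_pow, mul_pow, mul_pow, div_pow, Real.sq_sqrt hc.le, ← pow_mul,
      mul_comm k 2, pow_mul, ← Real.exp_nat_mul, Polynomial.eval_pow]
    rw [show ((2 : ℕ) : ℝ) * (-t ^ 2 / 2) = -t ^ 2 by push_cast; ring]
    simp
    ring
  simp only [h]
  rw [integral_const_mul, integral_gaussDerivPoly_sq, inv_mul_cancel₀ hc.ne']

theorem exists_abs_eval_le_exp (P : Polynomial ℝ) :
    ∃ C : ℝ, ∀ t : ℝ, |P.eval t| ≤ C * Real.exp (t ^ 2 / 4) := by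
  induction P using Polynomial.induction_on' with
  | add p q hp hq =>
    obtain ⟨C, hC⟩ := hp
    obtain ⟨D, hD⟩ := hq
    refine ⟨C + D, fun t => ?_⟩
    rw [Polynomial.eval_add, add_mul]
    exact (abs_add_le _ _).trans (add_le_add (hC t) (hD t))
  | monomial m a =>
    refine ⟨|a| * (1 + 4 ^ m * m.factorial), fun t => ?_⟩
    rw [Polynomial.eval_monomial, abs_mul, abs_pow, mul_assoc]
    gcongr
    have h1 : |t| ^ m ≤ 1 + (|t| ^ m) ^ 2 := by nlinarith [sq_nonneg (|t| ^ m - 1)]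
    have h2 : (|t| ^ m) ^ 2 = 4 ^ m * (t ^ 2 / 4) ^ m := by
      rw [← pow_mul, mul_comm, pow_mul, sq_abs, ← mul_pow]
      ring_nf
    have h3 : (t ^ 2 / 4) ^ m ≤ m.factorial * Real.exp (t ^ 2 / 4) := by
      have := Real.pow_div_factorial_le_exp (t ^ 2 / 4) (by positivity) m
      rwa [div_le_iff₀' (by positivity)] at this
    have h4 : 1 ≤ Real.exp (t ^ 2 / 4) := Real.one_le_exp (by positivity)
    have h5 : 4 ^ m * (t ^ 2 / 4) ^ m ≤ 4 ^ m * (m.factorial * Real.exp (t ^ 2 / 4)) := by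
      gcongr
    rw [h2] at h1
    linarith

/-- Half of the Gaussian absorbs the polynomial. The crude bound serves only as a dominating
function. -/
theorem exists_abs_hermiteFun_le (k : ℕ) :
    ∃ C : ℝ, ∀ t : ℝ, |hermiteFun k t| ≤ C * Real.exp (-t ^ 2 / 4) := by
  obtain ⟨P, hP⟩ := exists_hermiteFun_eq k
  obtain ⟨C, hC⟩ := exists_abs_eval_le_exp P
  refine ⟨C, fun t => ?_⟩
  rw [hP, abs_mul, Real.abs_exp]
  calc |P.eval t| * Real.exp (-t ^ 2 / 2)
      ≤ C * Real.exp (t ^ 2 / 4) * Real.exp (-t ^ 2 / 2) := by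
        gcongr
        exact hC t
    _ = C * Real.exp (-t ^ 2 / 4) := by
        rw [mul_assoc, ← Real.exp_add]
        ring_nf

theorem norm_toLp_sq {n : ℕ} {f : EuclideanSpace ℝ (Fin n) → ℂ}
    (hf : MemLp f 2 (volume : Measure (EuclideanSpace ℝ (Fin n)))) :
    ‖hf.toLp f‖ ^ 2 = ∫ ξ, ‖f ξ‖ ^ 2 := by
  rw [Lp.norm_toLp, hf.eLpNorm_eq_integral_rpow_norm two_ne_zero ENNReal.ofNat_ne_top,
    ENNReal.toReal_ofReal (by positivity)]
  simp only [ENNReal.toReal_ofNat, Real.rpow_two]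
  rw [← Real.rpow_natCast, ← Real.rpow_mul (integral_nonneg fun _ => by positivity)]
  simp

theorem norm_hermiteScaled {n : ℕ} [NeZero n] (α : Fin n → ℕ) {l : ℝ} (hl : l ≠ 0) :
    ‖hermiteScaled α l‖ = 1 := by
  have hl' : 0 < |l| := abs_pos.2 hl
  have h0 : 0 < |l| ^ (1 / 2 : ℝ) := by positivity
  rw [← sq_eq_sq₀ (norm_nonneg _) zero_le_one, one_pow, hermiteScaled, norm_toLp_sq,
    ← (PiLp.volume_preserving_toLp (Fin n)).integral_comp
    (MeasurableEquiv.toLp 2 _).measurableEmbedding]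
  have e : ∀ x : Fin n → ℝ, ‖hermiteScaledFun α l (WithLp.toLp 2 x)‖ ^ 2 =
      (|l| ^ ((n : ℝ) / 4)) ^ 2 * ∏ j, hermiteFun (α j) (|l| ^ (1 / 2 : ℝ) * x j) ^ 2 := by
    intro x
    simp only [hermiteScaledFun, Complex.norm_real, Real.norm_eq_abs, sq_abs, mul_pow,
      Finset.prod_pow]
  simp only [e]
  rw [integral_const_mul, integral_fintype_prod_volume_eq_prod
    (fun j (v : ℝ) => hermiteFun (α j) (|l| ^ (1 / 2 : ℝ) * v) ^ 2)]
  have e2 : ∀ j, ∫ v : ℝ, hermiteFun (α j) (|l| ^ (1 / 2 : ℝ) * v) ^ 2 =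
      (|l| ^ (1 / 2 : ℝ))⁻¹ := fun j => by
    rw [Measure.integral_comp_mul_left (fun v => hermiteFun (α j) v ^ 2), integral_hermiteFun_sq,
      abs_of_pos (by positivity), smul_eq_mul, mul_one]
  simp only [e2]
  rw [Finset.prod_const, Finset.card_univ, Fintype.card_fin, inv_pow, ← Real.rpow_natCast,
    ← Real.rpow_natCast, ← Real.rpow_mul hl'.le, ← Real.rpow_mul hl'.le, ← Real.rpow_neg hl'.le,
    ← Real.rpow_add hl']
  rw [show (n : ℝ) / 4 * ((2 : ℕ) : ℝ) + -(1 / 2 * (n : ℝ)) = 0 by push_cast; ring, Real.rpow_zero]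

/-! ### Continuity and size of the Fourier transform of a discrepancy measure -/

open Filter Topology

/-- Dominated convergence in `L²`. -/
theorem tendsto_toLp_of_dominated {n : ℕ} {X : Type*} [TopologicalSpace X]
    [FirstCountableTopology X] {F : X → EuclideanSpace ℝ (Fin n) → ℂ} {x₀ : X}
    (hF : ∀ x, MemLp (F x) 2 (volume : Measure (EuclideanSpace ℝ (Fin n))))
    (hlim : ∀ ξ, Tendsto (fun x => F x ξ) (𝓝 x₀) (𝓝 (F x₀ ξ)))
    {g : EuclideanSpace ℝ (Fin n) → ℝ} (hg : Integrable fun ξ => g ξ ^ 2)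
    (hb : ∀ᶠ x in 𝓝 x₀, ∀ ξ, ‖F x ξ‖ ≤ g ξ) :
    ContinuousAt (fun x => (hF x).toLp (F x)) x₀ := by
  rw [ContinuousAt, tendsto_iff_norm_sub_tendsto_zero]
  have key : Tendsto (fun x => ∫ ξ, ‖F x ξ - F x₀ ξ‖ ^ 2) (𝓝 x₀) (𝓝 (∫ _ : EuclideanSpace ℝ (Fin n), (0 : ℝ))) := by
    refine tendsto_integral_filter_of_dominated_convergence (fun ξ => 4 * g ξ ^ 2)
      (Eventually.of_forall fun x => ?_) ?_ (hg.const_mul 4) (Eventually.of_forall fun ξ => ?_)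
    · exact ((hF x).1.sub (hF x₀).1).norm.pow 2
    · filter_upwards [hb] with x hx
      refine Eventually.of_forall fun ξ => ?_
      have h1 := hx ξ
      have h2 := hb.self_of_nhds ξ
      have h3 := norm_sub_le (F x ξ) (F x₀ ξ)
      rw [Real.norm_of_nonneg (by positivity)]
      calc ‖F x ξ - F x₀ ξ‖ ^ 2 ≤ (2 * g ξ) ^ 2 := by
            gcongr
            linarith
        _ = 4 * g ξ ^ 2 := by ring
    · have := (((hlim ξ).sub_const (F x₀ ξ)).norm).pow 2
      simpa using this
  have h2 : ∀ x, ‖(hF x).toLp (F x) - (hF x₀).toLp (F x₀)‖ = √(∫ ξ, ‖F x ξ - F x₀ ξ‖ ^ 2) := by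
    intro x
    rw [← MemLp.toLp_sub, ← Real.sqrt_sq (norm_nonneg _), norm_toLp_sq]
    rfl
  simp only [h2]
  simpa [Function.comp_def] using (Real.continuous_sqrt.tendsto _).comp key

/-- Allows π_l(p) to be computed on the explicit representative, so that limits can be taken
pointwise in ξ. -/
theorem schrodinger_toLp {n : ℕ} (l : ℝ) (p : Heis n) {f : EuclideanSpace ℝ (Fin n) → ℂ}
    (hf : MemLp f 2 (volume : Measure (EuclideanSpace ℝ (Fin n)))) :
    ∃ h : MemLp (schrodingerFun l p f) 2 (volume : Measure (EuclideanSpace ℝ (Fin n))),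
      schrodinger l p (hf.toLp f) = h.toLp _ := by
  have hae : schrodingerFun l p (hf.toLp f) =ᵐ[volume] schrodingerFun l p f := by
    have := (measurePreserving_add_right (volume : Measure (EuclideanSpace ℝ (Fin n)))
      (imPart p.1)).quasiMeasurePreserving.ae_eq_comp hf.coeFn_toLp
    filter_upwards [this] with ξ hξ
    simp only [Function.comp] at hξ
    simp only [schrodingerFun, hξ]
  have h : MemLp (schrodingerFun l p f) 2 (volume : Measure (EuclideanSpace ℝ (Fin n))) :=
    (memLp_congr_ae hae).1 (memLp_schrodingerFun l p (hf.toLp f))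
  exact ⟨h, MemLp.toLp_congr _ _ hae⟩

theorem norm_schrodingerFun {n : ℕ} (l : ℝ) (p : Heis n) (f : EuclideanSpace ℝ (Fin n) → ℂ)
    (ξ : EuclideanSpace ℝ (Fin n)) : ‖schrodingerFun l p f ξ‖ = ‖f (ξ + imPart p.1)‖ := by
  unfold schrodingerFun
  rw [norm_mul, mul_assoc, ← Complex.ofReal_mul, mul_comm Complex.I,
    Complex.norm_exp_ofReal_mul_I, one_mul]

theorem norm_schrodinger {n : ℕ} (l : ℝ) (p : Heis n) (φ : L2 n) :
    ‖schrodinger l p φ‖ = ‖φ‖ := by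
  rw [← sq_eq_sq₀ (norm_nonneg _) (norm_nonneg _), schrodinger, norm_toLp_sq]
  simp only [norm_schrodingerFun]
  rw [integral_add_right_eq_self (fun ξ => ‖φ ξ‖ ^ 2) (imPart p.1), ← norm_toLp_sq (Lp.memLp φ),
    Lp.toLp_coeFn]

theorem continuous_rePart {n : ℕ} : Continuous (rePart : EuclideanSpace ℂ (Fin n) → _) := by
  unfold rePart
  fun_prop

theorem continuous_imPart {n : ℕ} : Continuous (imPart : EuclideanSpace ℂ (Fin n) → _) := by
  unfold imPart
  fun_prop

theorem integrable_exp_neg_mul_norm_sq {n : ℕ} {c : ℝ} (hc : 0 < c) :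
    Integrable fun ξ : EuclideanSpace ℝ (Fin n) => Real.exp (-c * ‖ξ‖ ^ 2) := by
  have := (GaussianFourier.integrable_cexp_neg_mul_sq_norm_add (V := EuclideanSpace ℝ (Fin n))
    (b := (c : ℂ)) (by simpa using hc) 0 0).norm
  refine this.congr (Eventually.of_forall fun ξ => ?_)
  simp only [zero_mul, add_zero, Complex.norm_exp]
  congr 1
  norm_cast

theorem exists_norm_hermiteScaledFun_le {n : ℕ} (α : Fin n → ℕ) :
    ∃ C : ℝ, ∀ (l : ℝ) (x : EuclideanSpace ℝ (Fin n)),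
      ‖hermiteScaledFun α l x‖ ≤ |l| ^ ((n : ℝ) / 4) * (C * Real.exp (-(|l| / 4) * ‖x‖ ^ 2)) := by
  choose C hC using fun j => exists_abs_hermiteFun_le (α j)
  refine ⟨∏ j, C j, fun l x => ?_⟩
  rw [hermiteScaledFun, Complex.norm_real, norm_mul, Real.norm_of_nonneg (by positivity)]
  gcongr
  rw [Real.norm_eq_abs, Finset.abs_prod, EuclideanSpace.real_norm_sq_eq, Finset.mul_sum,
    Real.exp_sum, ← Finset.prod_mul_distrib]
  refine Finset.prod_le_prod (fun _ _ => abs_nonneg _) fun j _ => (hC j _).trans_eq ?_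
  rw [mul_pow, ← Real.rpow_natCast (|l| ^ (1 / 2 : ℝ)), ← Real.rpow_mul (abs_nonneg l)]
  norm_num
  left
  ring

/-- Dominated convergence in L²: for nearby parameters |l| stays between half and twice its value
and the translation stays bounded by R, so one Gaussian dominates all the functions. -/
theorem continuousAt_schrodinger_hermiteScaled {n : ℕ} [NeZero n] (α : Fin n → ℕ)
    {q : ℝ × Heis n} (hq : q.1 ≠ 0) :
    ContinuousAt (fun q : ℝ × Heis n => schrodinger q.1 q.2 (hermiteScaled α q.1)) q := by
  have hl : 0 < |q.1| := abs_pos.2 hq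
  choose h e using fun q : ℝ × Heis n =>
    schrodinger_toLp q.1 q.2 (memLp_hermiteScaledFun α q.1)
  simp only [hermiteScaled, e]
  obtain ⟨C, hC⟩ := exists_norm_hermiteScaledFun_le α
  set c := |q.1| / 2 with hc
  set R := ‖imPart q.2.1‖ + 1 with hR
  have hC0 : 0 ≤ C := by
    have := (norm_nonneg _).trans (hC 1 0)
    simpa using this
  refine tendsto_toLp_of_dominated h (fun ξ => ?_)
    (g := fun ξ => (2 * |q.1|) ^ ((n : ℝ) / 4) * C * Real.exp (c * R ^ 2 / 4) *
      Real.exp (-(c / 8) * ‖ξ‖ ^ 2)) ?_ ?_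
  · have h1 : Continuous fun q : ℝ × Heis n => imPart q.2.1 :=
      continuous_imPart.comp (by fun_prop)
    have h2 : Continuous fun q : ℝ × Heis n => rePart q.2.1 :=
      continuous_rePart.comp (by fun_prop)
    refine ContinuousAt.mul (by fun_prop) ?_
    unfold hermiteScaledFun
    refine Complex.continuous_ofReal.continuousAt.comp (ContinuousAt.mul
      (ContinuousAt.rpow_const (by fun_prop) (Or.inl hl.ne')) ?_)
    refine tendsto_finsetProd _ fun j _ => ?_
    refine (continuous_hermiteFun (α j)).continuousAt.comp (ContinuousAt.mul
      (ContinuousAt.rpow_const (by fun_prop) (Or.inl hl.ne')) ?_)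
    exact ((EuclideanSpace.proj (𝕜 := ℝ) j).continuous.comp
      (continuous_const.add h1)).continuousAt
  · have : Integrable fun ξ : EuclideanSpace ℝ (Fin n) => Real.exp (-(c / 4) * ‖ξ‖ ^ 2) :=
      integrable_exp_neg_mul_norm_sq (by positivity)
    refine (this.const_mul
      (((2 * |q.1|) ^ ((n : ℝ) / 4) * C * Real.exp (c * R ^ 2 / 4)) ^ 2)).congr
      (Eventually.of_forall fun ξ => ?_)
    simp only
    rw [mul_pow _ (Real.exp (-(c / 8) * ‖ξ‖ ^ 2)), ← Real.exp_nat_mul]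
    congr 2
    push_cast
    ring
  · have h1 : ∀ᶠ q' : ℝ × Heis n in 𝓝 q, |q'.1| < 2 * |q.1| :=
      (continuous_fst.abs.tendsto q).eventually_lt_const (by linarith)
    have h2 : ∀ᶠ q' : ℝ × Heis n in 𝓝 q, c < |q'.1| :=
      (continuous_fst.abs.tendsto q).eventually_const_lt (by linarith)
    have h3 : ∀ᶠ q' : ℝ × Heis n in 𝓝 q, ‖imPart q'.2.1‖ < R :=
      ((continuous_imPart.comp (continuous_fst.comp continuous_snd)).norm.tendsto
        q).eventually_lt_const (by simp [hR])
    filter_upwards [h1, h2, h3] with q' a1 a2 a3 ξ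
    rw [norm_schrodingerFun]
    refine (hC _ _).trans ?_
    rw [mul_assoc, mul_assoc, ← Real.exp_add]
    gcongr
    have t1 : ‖ξ‖ ≤ ‖ξ + imPart q'.2.1‖ + R := by
      have := norm_sub_le (ξ + imPart q'.2.1) (imPart q'.2.1)
      rw [add_sub_cancel_right] at this
      linarith
    -- Trades the moving centre for a fixed one: it costs half of the Gaussian rate and the constant
    -- factor e^{cR²/4}.
    have t2 : ‖ξ‖ ^ 2 ≤ 2 * ‖ξ + imPart q'.2.1‖ ^ 2 + 2 * R ^ 2 := by
      have := pow_le_pow_left₀ (norm_nonneg _) t1 2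
      nlinarith [sq_nonneg (‖ξ + imPart q'.2.1‖ - R)]
    have t3 : c * ‖ξ + imPart q'.2.1‖ ^ 2 ≤ |q'.1| * ‖ξ + imPart q'.2.1‖ ^ 2 := by gcongr
    have t4 : c * ‖ξ‖ ^ 2 ≤ c * (2 * ‖ξ + imPart q'.2.1‖ ^ 2 + 2 * R ^ 2) := by gcongr
    linarith

/-! ### Discrepancy measures: Fourier transform and level masses -/

section FourierSigned

variable {n : ℕ} [NeZero n] {N : ℕ} (ζ : Fin N → Heis n) (μ : Measure (Heis n))
  [IsProbabilityMeasure μ] (α : Fin n → ℕ)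

theorem continuous_schrodinger_hermiteScaled_right (α : Fin n → ℕ) {l : ℝ} (hl : l ≠ 0) :
    Continuous fun p : Heis n => schrodinger l p (hermiteScaled α l) :=
  continuous_iff_continuousAt.2 fun p =>
    (continuousAt_schrodinger_hermiteScaled α (q := (l, p)) hl).comp
      (f := fun p : Heis n => (l, p)) (by fun_prop)

theorem continuousAt_schrodinger_hermiteScaled_left (α : Fin n → ℕ) {l : ℝ} (hl : l ≠ 0)
    (p : Heis n) : ContinuousAt (fun l => schrodinger l p (hermiteScaled α l)) l :=
  (continuousAt_schrodinger_hermiteScaled α (q := (l, p)) hl).comp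
      (f := fun l : ℝ => (l, p)) (by fun_prop)

theorem integrable_schrodinger_hermiteScaled (μ : Measure (Heis n)) [IsFiniteMeasure μ]
    (α : Fin n → ℕ) {l : ℝ} (hl : l ≠ 0) :
    Integrable (fun p => schrodinger l p (hermiteScaled α l)) μ :=
  Integrable.of_bound (continuous_schrodinger_hermiteScaled_right α hl).aestronglyMeasurable 1
    (Eventually.of_forall fun p => by rw [norm_schrodinger, norm_hermiteScaled α hl])

theorem fourierSigned_discMeasure {l : ℝ} (hl : l ≠ 0) :
    fourierSigned (discMeasure ζ μ) l (hermiteScaled α l) =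
      ∑ j, schrodinger l (ζ j) (hermiteScaled α l) -
        (N : ℝ) • ∫ p, schrodinger l p (hermiteScaled α l) ∂μ := by
  have hi : ∀ (ν : Measure (Heis n)) [IsFiniteMeasure ν],
      ν.toSignedMeasure.Integrable fun p => schrodinger l p (hermiteScaled α l) := fun ν _ => by
    rw [VectorMeasure.Integrable, Measure.variation_toSignedMeasure]
    exact integrable_schrodinger_hermiteScaled ν α hl
  rw [fourierSigned, discMeasure, VectorMeasure.integral_sub_vectorMeasure
    (VectorMeasure.Integrable.finsetSum_vectorMeasure fun j _ => hi _)
    ((hi μ).smul_vectorMeasure _), VectorMeasure.integral_finsetSum_vectorMeasure fun j _ => hi _,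
    VectorMeasure.integral_smul_vectorMeasure]
  simp only [VectorMeasure.integral_toSignedMeasure, integral_dirac]

/-- The N point masses and N times the probability measure each contribute at most N, by unitarity.
-/
theorem norm_fourierSigned_discMeasure_le {l : ℝ} (hl : l ≠ 0) :
    ‖fourierSigned (discMeasure ζ μ) l (hermiteScaled α l)‖ ≤ 2 * N := by
  have h1 : ∀ p : Heis n, ‖schrodinger l p (hermiteScaled α l)‖ ≤ 1 := fun p => by
    rw [norm_schrodinger, norm_hermiteScaled α hl]
  rw [fourierSigned_discMeasure ζ μ α hl]
  refine (norm_sub_le _ _).trans ?_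
  have a1 : ‖∑ j, schrodinger l (ζ j) (hermiteScaled α l)‖ ≤ N := by
    refine (norm_sum_le_of_le _ fun j _ => h1 (ζ j)).trans_eq ?_
    simp
  have a2 : ‖∫ p, schrodinger l p (hermiteScaled α l) ∂μ‖ ≤ 1 := by
    refine (norm_integral_le_of_norm_le_const (Eventually.of_forall h1)).trans_eq ?_
    simp
  rw [norm_smul, Real.norm_of_nonneg (Nat.cast_nonneg N)]
  have : (0 : ℝ) ≤ N := Nat.cast_nonneg N
  nlinarith

theorem continuousAt_fourierSigned_discMeasure {l : ℝ} (hl : l ≠ 0) :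
    ContinuousAt (fun l => fourierSigned (discMeasure ζ μ) l (hermiteScaled α l)) l := by
  have hev : ∀ᶠ l' : ℝ in 𝓝 l, l' ≠ 0 := isOpen_ne.mem_nhds hl
  have : ContinuousAt (fun l => ∑ j, schrodinger l (ζ j) (hermiteScaled α l) -
      (N : ℝ) • ∫ p, schrodinger l p (hermiteScaled α l) ∂μ) l := by
    refine ContinuousAt.sub (tendsto_finsetSum _ fun j _ =>
      continuousAt_schrodinger_hermiteScaled_left α hl (ζ j)) (Tendsto.const_smul (c := (N : ℝ)) ?_)
    refine continuousAt_of_dominated (bound := fun _ => 1) ?_ ?_ (integrable_const _)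
      (Eventually.of_forall fun p => continuousAt_schrodinger_hermiteScaled_left α hl p)
    · filter_upwards [hev] with l' hl'
      exact (continuous_schrodinger_hermiteScaled_right α hl').aestronglyMeasurable
    · filter_upwards [hev] with l' hl'
      exact Eventually.of_forall fun p => by rw [norm_schrodinger, norm_hermiteScaled α hl']
  refine this.congr ?_
  filter_upwards [hev] with l' hl'
  exact (fourierSigned_discMeasure ζ μ α hl').symm

theorem continuousAt_levelMass (k : ℕ) {l : ℝ} (hl : l ≠ 0) :
    ContinuousAt (levelMass (discMeasure ζ μ) k) l :=
  tendsto_finsetSum _ fun α _ => (continuousAt_fourierSigned_discMeasure ζ μ α hl).norm.pow 2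

/-- The prescribed sum determines the first coordinate from the other n - 1, each of which is at
most k. -/
theorem card_piAntidiag_le (n k : ℕ) [NeZero n] :
    (Finset.piAntidiag (Finset.univ : Finset (Fin n)) k).card ≤ (k + 1) ^ (n - 1) := by
  obtain ⟨m, rfl⟩ : ∃ m, n = m + 1 := ⟨n - 1, (Nat.sub_add_cancel NeZero.one_le).symm⟩
  have : (Fintype.piFinset fun _ : Fin m => Finset.range (k + 1)).card = (k + 1) ^ m := by simp
  rw [Nat.add_sub_cancel, ← this]
  refine Finset.card_le_card_of_injOn (fun α j => α j.succ) (fun α hα => ?_) fun α hα β hβ h => ?_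
  · simp only [Finset.mem_coe, Finset.mem_piAntidiag] at hα
    simp only [Finset.mem_coe, Fintype.mem_piFinset, Finset.mem_range, Nat.lt_succ_iff]
    intro j
    rw [← hα.1]
    exact Finset.single_le_sum (f := α) (fun _ _ => Nat.zero_le _) (Finset.mem_univ _)
  · simp only [Finset.mem_coe, Finset.mem_piAntidiag, Fin.sum_univ_succ] at hα hβ
    have h' : ∀ j : Fin m, α j.succ = β j.succ := fun j => congrFun h j
    ext j
    refine Fin.cases ?_ h' j
    have := hα.1.trans hβ.1.symm
    simp only [h'] at this
    omega

theorem levelMass_nonneg (σ : SignedMeasure (Heis n)) (k : ℕ) (l : ℝ) : 0 ≤ levelMass σ k l :=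
  Finset.sum_nonneg fun _ _ => by positivity

theorem levelMass_discMeasure_le (k : ℕ) {l : ℝ} (hl : l ≠ 0) :
    levelMass (discMeasure ζ μ) k l ≤ ((k : ℝ) + 1) ^ (n - 1) * (4 * (N : ℝ) ^ 2) := by
  calc levelMass (discMeasure ζ μ) k l
      ≤ ∑ _α ∈ Finset.piAntidiag (Finset.univ : Finset (Fin n)) k, (2 * (N : ℝ)) ^ 2 :=
        Finset.sum_le_sum fun α _ => by
          gcongr
          exact norm_fourierSigned_discMeasure_le ζ μ α hl
    _ = ((Finset.piAntidiag (Finset.univ : Finset (Fin n)) k).card : ℝ) * (4 * (N : ℝ) ^ 2) := by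
        rw [Finset.sum_const, nsmul_eq_mul]
        ring
    _ ≤ _ := by
        gcongr
        exact_mod_cast card_piAntidiag_le n k

end FourierSigned

/-! ### Estimate of the tail -/

theorem integral_exp_neg_abs : ∫ x : ℝ, Real.exp (-|x|) = 2 := by
  rw [integral_comp_abs (f := fun x => Real.exp (-x)), integral_exp_neg_Ioi_zero, mul_one]

theorem integrable_exp_neg_abs : Integrable fun x : ℝ => Real.exp (-|x|) :=
  .of_integral_ne_zero (by simp [integral_exp_neg_abs])

theorem integrable_exp_neg_abs_affine {a : ℝ} (ha : 0 < a) (c : ℝ) :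
    Integrable fun x : ℝ => Real.exp (-|a * x + c|) :=
  (integrable_exp_neg_abs.comp_add_right c).comp_mul_left' ha.ne'

theorem integral_exp_neg_abs_affine {a : ℝ} (ha : 0 < a) (c : ℝ) :
    ∫ x : ℝ, Real.exp (-|a * x + c|) = 2 / a := by
  rw [Measure.integral_comp_mul_left (fun x => Real.exp (-|x + c|)),
    integral_add_right_eq_self (fun x => Real.exp (-|x|)), integral_exp_neg_abs,
    abs_of_pos (inv_pos.2 ha), smul_eq_mul]
  ring

/-- With y = x - (Λ - 1), the condition sΛ > 1 gives x ≤ Λ(1 + sy). The power of 1 + sy is absorbed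
by e^{(1+sy)/4}, leaving decay e^{-sy/4}; s < 1 bounds the remaining constant 1/4 + s/2 by 3/4. -/
theorem pow_mul_exp_le (n : ℕ) {s Λ x : ℝ} (hs : 0 < s) (hs1 : s < 1) (hΛ : 1 < s * Λ)
    (hx0 : 0 ≤ x) (hx : Λ - 1 < x) :
    x ^ n * Real.exp (-(s * x) / 2) ≤ 4 ^ n * n.factorial * Real.exp (3 / 4) *
      (Λ ^ n * Real.exp (-(s * Λ) / 2)) * Real.exp (-(s / 4 * (x - (Λ - 1)))) := by
  have hΛ0 : 0 < Λ := by
    by_contra h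
    nlinarith
  set y := x - (Λ - 1) with hy
  have hy0 : 0 < y := by linarith
  have h1 : x ≤ Λ * (1 + s * y) := by nlinarith
  have h2 : (1 + s * y) ^ n ≤ 4 ^ n * (n.factorial * Real.exp ((1 + s * y) / 4)) := by
    have := Real.pow_div_factorial_le_exp ((1 + s * y) / 4) (by positivity) n
    rw [div_le_iff₀' (by positivity), div_pow, div_le_iff₀' (by positivity)] at this
    exact this
  calc x ^ n * Real.exp (-(s * x) / 2)
      ≤ (Λ * (1 + s * y)) ^ n * Real.exp (-(s * x) / 2) := by gcongr
    _ ≤ Λ ^ n * (4 ^ n * (n.factorial * Real.exp ((1 + s * y) / 4))) *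
          Real.exp (-(s * x) / 2) := by
        rw [mul_pow]
        gcongr
    _ = 4 ^ n * n.factorial * Λ ^ n * Real.exp ((1 + s * y) / 4 + -(s * x) / 2) := by
        rw [Real.exp_add]
        ring
    _ ≤ 4 ^ n * n.factorial * Λ ^ n *
          Real.exp (3 / 4 + -(s * Λ) / 2 + -(s / 4 * y)) := by
        have : (1 + s * y) / 4 + -(s * x) / 2 ≤ 3 / 4 + -(s * Λ) / 2 + -(s / 4 * y) := by
          rw [hy]
          linarith
        gcongr
    _ = _ := by
        rw [Real.exp_add, Real.exp_add]
        ring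

/-- As n ≥ 1, ν_k ≥ 4k + 2, the midpoint of 4k and 4k + 4. Each term is thus at most a telescoping
difference, and the induction carries the remainder. -/
theorem sum_inv_sq_le (n : ℕ) [NeZero n] {Λ : ℝ} (hΛ : 0 < Λ) (m : ℕ) :
    ∑ k ∈ Finset.range m, 1 / (nu n k + Λ / 2) ^ 2 ≤ 1 / (2 * Λ) := by
  have hn : (1 : ℝ) ≤ n := by exact_mod_cast NeZero.one_le (n := n)
  suffices h : ∑ k ∈ Finset.range m, 1 / (nu n k + Λ / 2) ^ 2 ≤
      1 / (2 * Λ) - 1 / 4 * (1 / (4 * (m : ℝ) + Λ / 2)) by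
    have : 0 ≤ 1 / 4 * (1 / (4 * (m : ℝ) + Λ / 2)) := by positivity
    linarith
  induction m with
  | zero =>
    simp
    field_simp
    norm_num
  | succ m ih =>
    rw [Finset.sum_range_succ]
    have h1 : 1 / (nu n m + Λ / 2) ^ 2 ≤
        1 / ((4 * (m : ℝ) + Λ / 2) * (4 * ((m + 1 : ℕ) : ℝ) + Λ / 2)) := by
      refine one_div_le_one_div_of_le (by positivity) ?_
      have h : 4 * (m : ℝ) + 2 + Λ / 2 ≤ nu n m + Λ / 2 := by
        unfold nu
        linarith
      calc _ ≤ (4 * (m : ℝ) + 2 + Λ / 2) ^ 2 := by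
            push_cast
            nlinarith
        _ ≤ _ := by gcongr
    have h2 : 1 / ((4 * (m : ℝ) + Λ / 2) * (4 * ((m + 1 : ℕ) : ℝ) + Λ / 2)) =
        1 / 4 * (1 / (4 * (m : ℝ) + Λ / 2)) - 1 / 4 * (1 / (4 * ((m + 1 : ℕ) : ℝ) + Λ / 2)) := by
      have : 0 < 4 * (m : ℝ) + Λ / 2 := by positivity
      have : 0 < 4 * ((m + 1 : ℕ) : ℝ) + Λ / 2 := by positivity
      field_simp
      push_cast
      ring
    linarith

section Tail

variable {n : ℕ} [NeZero n]

theorem coeffConst_pos (n : ℕ) : 0 < coeffConst n := by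
  have := Real.pi_pos
  unfold coeffConst
  positivity

theorem aestronglyMeasurable_tailIntegrand {Ψ : 𝓢(ℝ, ℝ)}
    (hΨ : tsupport Ψ ⊆ Set.Icc (-(1 / 2)) (1 / 2)) (μ : Measure (Heis n))
    [IsProbabilityMeasure μ] {N : ℕ} (ζ : Fin N → Heis n) {s : ℝ} (hs : 0 < s) (Λ : ℝ) (k : ℕ) :
    AEStronglyMeasurable (tailIntegrand Ψ (discMeasure ζ μ) s Λ k) := by
  have h1 : AEStronglyMeasurable fun l : ℝ =>
      (regionF n Λ)ᶜ.indicator (fun _ => (1 : ℂ)) (k, l) := by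
    refine Measurable.aestronglyMeasurable ?_
    have : MeasurableSet {l : ℝ | (k, l) ∈ (regionF n Λ)ᶜ} := by
      have : MeasurableSet {l : ℝ | l ≠ 0 ∧ 1 + |l * nu n k| ≤ Λ ∧ |l| ≤ 1} := by
        refine MeasurableSet.inter (measurableSet_singleton (0 : ℝ)).compl
          (MeasurableSet.inter ?_ ?_)
        · exact measurableSet_le (f := fun l : ℝ => 1 + |l * nu n k|) (by fun_prop)
            measurable_const
        · exact measurableSet_le (f := fun l : ℝ => |l|) (by fun_prop) measurable_const
      exact this.compl
    exact (measurable_const (a := (1 : ℂ))).indicator this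
  have h2 : AEStronglyMeasurable fun l : ℝ => radialCoeff (kernelK (n := n) Ψ s) l k := by
    have hc : Continuous fun l : ℝ => cutoffSymbol Ψ (l / (2 * Real.pi)) *
        ((coeffConst n * Real.exp (-(2 * k + n) * |l| * s) : ℝ) : ℂ) := by
      have := (cutoffSymbol Ψ).continuous
      fun_prop
    refine hc.aestronglyMeasurable.congr ?_
    filter_upwards [compl_mem_ae_iff.2 (measure_singleton (0 : ℝ))] with l hl
    exact (radialCoeff_kernelK hΨ hs hl k).symm
  have h3 : AEStronglyMeasurable fun l : ℝ => (levelMass (discMeasure ζ μ) k l : ℂ) := by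
    have hc : ContinuousOn (fun l : ℝ => (levelMass (discMeasure ζ μ) k l : ℂ)) {0}ᶜ :=
      fun l hl => (Complex.continuous_ofReal.continuousAt.comp
        (continuousAt_levelMass ζ μ k hl)).continuousWithinAt
    have := hc.aestronglyMeasurable (μ := volume) (measurableSet_singleton (0 : ℝ)).compl
    rwa [restrict_compl_singleton] at this
  have h4 : AEStronglyMeasurable fun l : ℝ => ((|l| ^ n : ℝ) : ℂ) :=
    Continuous.aestronglyMeasurable (by fun_prop)
  exact ((h1.mul h2).mul h3).mul h4

/-- An integrable majorant of the `k`-th integrand of the tail. -/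
def tailMajorant (n N : ℕ) (s Λ : ℝ) (k : ℕ) (l : ℝ) : ℝ :=
  coeffConst n * (4 * (N : ℝ) ^ 2) * (4 ^ n * n.factorial * Real.exp (3 / 4)) *
    (Λ ^ n * Real.exp (-(s * Λ) / 2)) * (4 * nu n k / (nu n k + Λ / 2) ^ 2) *
    (Real.exp (-|s / 4 * nu n k * l + -(s / 4 * (Λ - 1))|) +
      Real.exp (-|s / 4 * nu n k * l + s / 4 * (Λ - 1)|))

theorem nu_pos (k : ℕ) : 0 < nu n k := by
  have : (0 : ℝ) < n := by exact_mod_cast NeZero.pos n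
  unfold nu
  positivity

theorem norm_tailIntegrand_le {Ψ : 𝓢(ℝ, ℝ)}
    (hΨ : tsupport Ψ ⊆ Set.Icc (-(1 / 2)) (1 / 2)) (hΨ2 : (∫ x : ℝ, Ψ x ^ 2) = 2 * Real.pi)
    (μ : Measure (Heis n)) [IsProbabilityMeasure μ] {N : ℕ} (ζ : Fin N → Heis n) {s Λ : ℝ}
    (hs : 0 < s) (hs1 : s < 1) (hΛ : 1 < s * Λ) (k : ℕ) {l : ℝ} (hl : l ≠ 0) :
    ‖tailIntegrand Ψ (discMeasure ζ μ) s Λ k l‖ ≤ tailMajorant n N s Λ k l := by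
  have hΛ0 : 0 < Λ := by
    by_contra h
    nlinarith
  have hν := nu_pos (n := n) k
  have hc := coeffConst_pos n
  have hn : (1 : ℝ) ≤ n := by exact_mod_cast NeZero.one_le (n := n)
  have h0 : 0 ≤ tailMajorant n N s Λ k l := by
    unfold tailMajorant
    positivity
  by_cases hreg : (k, l) ∈ regionF n Λ
  · simpa [tailIntegrand, hreg] using h0
  -- Outside F_Λ the condition |l| ≤ 1 may fail, but there the cutoff symbol vanishes.
  by_cases hl1 : 1 < |l|
  · have : cutoffSymbol Ψ (l / (2 * Real.pi)) = 0 :=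
      cutoffSymbol_eq_zero hΨ (by rwa [mul_div_cancel₀ _ Real.two_pi_pos.ne'])
    simpa [tailIntegrand, radialCoeff_kernelK hΨ hs hl, this] using h0
  have hl1 : |l| ≤ 1 := not_lt.1 hl1
  set ν := nu n k with hνd
  have hx : Λ - 1 < |l| * ν := by
    by_contra h
    refine hreg ⟨hl, ?_, hl1⟩
    rw [abs_mul, abs_of_pos hν]
    linarith
  have hm0 := levelMass_nonneg (discMeasure ζ μ) k l
  have hm := levelMass_discMeasure_le ζ μ k hl
  have hind : (regionF n Λ)ᶜ.indicator (fun _ => (1 : ℂ)) (k, l) = 1 :=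
    Set.indicator_of_mem hreg _
  have hexp : -(2 * (k : ℝ) + n) * |l| * s = -(s * (|l| * ν)) / 2 := by
    rw [hνd, nu]
    ring
  have hνk : (k : ℝ) + 1 ≤ ν := by
    rw [hνd, nu]
    have : (0 : ℝ) ≤ k := k.cast_nonneg
    linarith
  have hν2 : 2 ≤ ν := by
    rw [hνd, nu]
    have : (0 : ℝ) ≤ k := k.cast_nonneg
    linarith
  -- The multiplicity has degree n - 1 against |l|ⁿ, which leaves one factor 1/ν; the integration in
  -- l supplies the second.
  have hpow : ((k : ℝ) + 1) ^ (n - 1) * |l| ^ n ≤ (|l| * ν) ^ n * ν⁻¹ := by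
    have e : ν ^ n = ν ^ (n - 1) * ν := by
      rw [← pow_succ, Nat.sub_add_cancel NeZero.one_le]
    have : ((k : ℝ) + 1) ^ (n - 1) ≤ ν ^ (n - 1) := by gcongr
    calc _ ≤ ν ^ (n - 1) * |l| ^ n := by gcongr
      _ = _ := by
        rw [mul_pow, e]
        field_simp
  -- From Λ - 1 < |l|ν ≤ ν and ν ≥ 2 it follows that Λ/2 ≤ ν. The weight with Λ/2 records this
  -- restriction on k, so the majorant can be summed over all k.
  have hinv : ν⁻¹ ≤ 4 * ν / (ν + Λ / 2) ^ 2 := by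
    have h1 : |l| * ν ≤ 1 * ν := by gcongr
    have h2 : ν + Λ / 2 ≤ 2 * ν := by linarith
    rw [le_div_iff₀ (by positivity), inv_mul_le_iff₀ hν]
    calc (ν + Λ / 2) ^ 2 ≤ (2 * ν) ^ 2 := by gcongr
      _ = _ := by ring
  -- One two-sided exponential for each sign of l gives a majorant that is integrable over the whole
  -- line in closed form.
  have hE : Real.exp (-(s / 4 * (|l| * ν - (Λ - 1)))) ≤
      Real.exp (-|s / 4 * ν * l + -(s / 4 * (Λ - 1))|) +
      Real.exp (-|s / 4 * ν * l + s / 4 * (Λ - 1)|) := by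
    have hy : 0 ≤ s / 4 * (|l| * ν - (Λ - 1)) := by
      have : 0 < |l| * ν - (Λ - 1) := by linarith
      positivity
    rcases abs_cases l with ⟨h, -⟩ | ⟨h, -⟩
    · refine le_add_of_le_of_nonneg (le_of_eq ?_) (Real.exp_pos _).le
      rw [show s / 4 * ν * l + -(s / 4 * (Λ - 1)) = s / 4 * (|l| * ν - (Λ - 1)) by rw [h]; ring,
        abs_of_nonneg hy]
    · refine le_add_of_nonneg_of_le (Real.exp_pos _).le (le_of_eq ?_)
      rw [show s / 4 * ν * l + s / 4 * (Λ - 1) = -(s / 4 * (|l| * ν - (Λ - 1))) by rw [h]; ring,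
        abs_neg, abs_of_nonneg hy]
  rw [tailIntegrand, hind, one_mul, radialCoeff_kernelK hΨ hs hl, norm_mul, norm_mul, norm_mul,
    Complex.norm_real, Complex.norm_real, Complex.norm_real,
    Real.norm_of_nonneg (by positivity), Real.norm_of_nonneg hm0,
    Real.norm_of_nonneg (by positivity), hexp]
  calc ‖cutoffSymbol Ψ (l / (2 * Real.pi))‖ *
        (coeffConst n * Real.exp (-(s * (|l| * ν)) / 2)) * levelMass (discMeasure ζ μ) k l * |l| ^ n
      ≤ 1 * (coeffConst n * Real.exp (-(s * (|l| * ν)) / 2)) *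
          (((k : ℝ) + 1) ^ (n - 1) * (4 * (N : ℝ) ^ 2)) * |l| ^ n := by
        gcongr
        exact norm_cutoffSymbol_le_one hΨ2 _
    _ = coeffConst n * (4 * (N : ℝ) ^ 2) * Real.exp (-(s * (|l| * ν)) / 2) *
          (((k : ℝ) + 1) ^ (n - 1) * |l| ^ n) := by ring
    _ ≤ coeffConst n * (4 * (N : ℝ) ^ 2) * Real.exp (-(s * (|l| * ν)) / 2) *
          ((|l| * ν) ^ n * ν⁻¹) := by gcongr
    _ = coeffConst n * (4 * (N : ℝ) ^ 2) *
          ((|l| * ν) ^ n * Real.exp (-(s * (|l| * ν)) / 2)) * ν⁻¹ := by ring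
    _ ≤ coeffConst n * (4 * (N : ℝ) ^ 2) * (4 ^ n * n.factorial * Real.exp (3 / 4) *
          (Λ ^ n * Real.exp (-(s * Λ) / 2)) * Real.exp (-(s / 4 * (|l| * ν - (Λ - 1))))) *
          (4 * ν / (ν + Λ / 2) ^ 2) := by
        have := pow_mul_exp_le n hs hs1 hΛ (x := |l| * ν) (by positivity) hx
        refine mul_le_mul (mul_le_mul_of_nonneg_left this (by positivity)) hinv (by positivity)
          (by positivity)
    _ = coeffConst n * (4 * (N : ℝ) ^ 2) * (4 ^ n * n.factorial * Real.exp (3 / 4)) *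
          (Λ ^ n * Real.exp (-(s * Λ) / 2)) * (4 * ν / (ν + Λ / 2) ^ 2) *
          Real.exp (-(s / 4 * (|l| * ν - (Λ - 1)))) := by ring
    _ ≤ tailMajorant n N s Λ k l := by
        unfold tailMajorant
        gcongr

theorem integrable_tailMajorant (N : ℕ) {s : ℝ} (hs : 0 < s) (Λ : ℝ) (k : ℕ) :
    Integrable (tailMajorant n N s Λ k) := by
  have := nu_pos (n := n) k
  exact ((integrable_exp_neg_abs_affine (by positivity) _).add
    (integrable_exp_neg_abs_affine (by positivity) _)).const_mul _

/-- The two exponentials integrate to 16/(sν) together; against the weight 4ν/(ν + Λ/2)² this gives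
the factor 64. -/
theorem integral_tailMajorant (N : ℕ) {s Λ : ℝ} (hs : 0 < s) (k : ℕ) :
    ∫ l, tailMajorant n N s Λ k l =
      64 * (coeffConst n * (4 * (N : ℝ) ^ 2) * (4 ^ n * n.factorial * Real.exp (3 / 4)) *
        (Λ ^ n * Real.exp (-(s * Λ) / 2))) * s⁻¹ * (1 / (nu n k + Λ / 2) ^ 2) := by
  have hν := nu_pos (n := n) k
  have ha : 0 < s / 4 * nu n k := by positivity
  simp only [tailMajorant]
  rw [integral_const_mul, integral_add (integrable_exp_neg_abs_affine ha _)
    (integrable_exp_neg_abs_affine ha _), integral_exp_neg_abs_affine ha,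
    integral_exp_neg_abs_affine ha]
  field_simp
  ring

end Tail

end HeisenbergDiscrepancy

/-! ### Summation over k and the final bound -/

open HeisenbergDiscrepancy

theorem proposition7p6 (n : ℕ) [NeZero n] :
    ∃ C : ℝ, 0 < C ∧
      ∀ Ψ : SchwartzMap ℝ ℝ, (∀ x, 0 ≤ Ψ x) → (∀ x, Ψ (-x) = Ψ x) →
        tsupport Ψ ⊆ Set.Icc (-(1 / 2)) (1 / 2) → (∫ x : ℝ, Ψ x ^ 2) = 2 * Real.pi →
      ∀ (μ : MeasureTheory.Measure (HeisenbergDiscrepancy.Heis n))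
        [MeasureTheory.IsProbabilityMeasure μ]
        (N : ℕ) (ζ : Fin N → HeisenbergDiscrepancy.Heis n) (s Λ : ℝ),
        0 < s → s < 1 → 1 < s * Λ →
        (∀ k, MeasureTheory.Integrable (HeisenbergDiscrepancy.tailIntegrand Ψ
            (HeisenbergDiscrepancy.discMeasure ζ μ) s Λ k)) ∧
        Summable (fun k : ℕ => ∫ l : ℝ, ‖HeisenbergDiscrepancy.tailIntegrand Ψ
            (HeisenbergDiscrepancy.discMeasure ζ μ) s Λ k l‖) ∧
        ‖HeisenbergDiscrepancy.tailB Ψ (HeisenbergDiscrepancy.discMeasure ζ μ) s Λ‖ ≤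
          C * (N : ℝ) ^ 2 * s⁻¹ * Λ ^ ((HeisenbergDiscrepancy.homDim n - 4) / 2) *
            Real.exp (-(s * Λ) / 2) := by
  have hc := coeffConst_pos n
  -- 128 = 64 · 4 · (1/2): the integral in l, the square of 2N, and the sum over k.
  refine ⟨128 * coeffConst n * (4 ^ n * n.factorial * Real.exp (3 / 4)), by positivity, ?_⟩
  intro Ψ _ _ hΨ hΨ2 μ _ N ζ s Λ hs hs1 hΛ
  have hΛ0 : 0 < Λ := by
    by_contra h
    nlinarith
  have hae : ∀ k, ∀ᵐ l : ℝ, ‖tailIntegrand Ψ (discMeasure ζ μ) s Λ k l‖ ≤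
      tailMajorant n N s Λ k l := fun k => by
    filter_upwards [compl_mem_ae_iff.2 (measure_singleton (0 : ℝ))] with l hl
    exact norm_tailIntegrand_le hΨ hΨ2 μ ζ hs hs1 hΛ k hl
  have hint : ∀ k, Integrable (tailIntegrand Ψ (discMeasure ζ μ) s Λ k) := fun k =>
    (integrable_tailMajorant N hs Λ k).mono'
      (aestronglyMeasurable_tailIntegrand hΨ μ ζ hs Λ k) (hae k)
  have hle : ∀ k, ∫ l, ‖tailIntegrand Ψ (discMeasure ζ μ) s Λ k l‖ ≤
      ∫ l, tailMajorant n N s Λ k l := fun k =>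
    integral_mono_ae (hint k).norm (integrable_tailMajorant N hs Λ k) (hae k)
  set M := 64 * (coeffConst n * (4 * (N : ℝ) ^ 2) * (4 ^ n * n.factorial * Real.exp (3 / 4)) *
    (Λ ^ n * Real.exp (-(s * Λ) / 2))) * s⁻¹ with hM
  have hM0 : 0 ≤ M := by positivity
  have hpos : ∀ k, 0 ≤ ∫ l, ‖tailIntegrand Ψ (discMeasure ζ μ) s Λ k l‖ := fun k =>
    integral_nonneg fun _ => norm_nonneg _
  have hsum : ∀ m, ∑ k ∈ Finset.range m, ∫ l, ‖tailIntegrand Ψ (discMeasure ζ μ) s Λ k l‖ ≤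
      M * (1 / (2 * Λ)) := fun m => by
    calc _ ≤ ∑ k ∈ Finset.range m, M * (1 / (nu n k + Λ / 2) ^ 2) :=
          Finset.sum_le_sum fun k _ => (hle k).trans_eq (integral_tailMajorant N hs k)
      _ ≤ _ := by
          rw [← Finset.mul_sum]
          gcongr
          exact sum_inv_sq_le n hΛ0 m
  have hS := summable_of_sum_range_le hpos hsum
  refine ⟨hint, hS, ?_⟩
  have hnorm : ∀ k, ‖∫ l, tailIntegrand Ψ (discMeasure ζ μ) s Λ k l‖ ≤
      ∫ l, ‖tailIntegrand Ψ (discMeasure ζ μ) s Λ k l‖ := fun k =>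
    norm_integral_le_integral_norm _
  refine ((tsum_of_norm_bounded hS.hasSum hnorm).trans
    (Real.tsum_le_of_sum_range_le hpos hsum)).trans_eq ?_
  -- Since (Q - 4)/2 = n - 1, the factor 1/Λ from the sum over k gives exactly the required power.
  have e : Λ ^ ((homDim n - 4) / 2) = Λ ^ n / Λ := by
    rw [show (homDim n - 4) / 2 = (n : ℝ) - 1 by unfold homDim; ring, Real.rpow_sub_one hΛ0.ne',
      Real.rpow_natCast]
  rw [e, hM]
  field_simp
  ring

end
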